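/- Let $\mathcal D$ be a directed acyclic graph with vertices $1,\dots,p$ in a parent ordering ($i\to j$ implies $i>j$). Write $\mathrm{pa}(j)=\{i: i\to j\}$, $\mathrm{fa}(j)=\mathrm{pa}(j)\cup\{j\}$, $pa_j=|\mathrm{pa}(j)|$ and $E=\{(i,j): i\in \mathrm{fa}(j)\}$. For a $p\times p$ matrix $A$ let $A_s$ be its principal submatrix on $s\subseteq\{1,\dots,p\}$, let $A_{ii|\mathrm{pa}(i)}=A_{ii}-A_{i,\mathrm{pa}(i)}(A_{\mathrm{pa}(i)})^{-1}A_{\mathrm{pa}(i),i}$, and for symmetric $A$ let $A^E=(A_{ij})_{(i,j)\in E}$, an element of the space $I_{\mathcal D}\cong\mathbb R^{E}$ of incomplete symmetric matrices. For a matrix or incomplete matrix $B$ let $(B)^0$ be the symmetric $p\times p$ matrix obtained by filling the unspecified entries with zeros. Let $P_{\mathcal D}$ be the set of inverses $\Sigma^{-1}$ of positive definite $\Sigma$ such that $x\sim N_p(0,\Sigma)$ satisfies $x_i\perp x_{\{j>i\}\setminus\mathrm{pa}(i)}\mid x_{\mathrm{pa}(i)}$ for every $i$, and let $R_{\mathcal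 D}=\{\Omega^E:\Omega\in P_{\mathcal D}\}$. Let $\Theta_{\mathcal D}$ be the set of pairs $(D,L)$ with $D$ diagonal with positive diagonal entries and $L$ lower triangular with unit diagonal and $L_{ij}=0$ for $i\ne j$, $i\notin\mathrm{pa}(j)$. Let $U$ be positive definite and $\alpha\in\mathbb R^p$ with $\alpha_i>pa_i+2$ for all $i$. Let $$z_{\mathcal D}(U,\alpha)=\prod_{i=1}^p\frac{\Gamma(\frac{\alpha_i}2-\frac{pa_i}2-1)\,2^{\frac{\alpha_i}2-1}(\sqrt\pi)^{pa_i}\det(U_{\mathrm{pa}(i)})^{\frac{\alpha_i}2-\frac{pa_i}2-\frac32}}{\det(U_{\mathrm{fa}(i)})^{\frac{\alpha_i}2-\frac{pa_i}2-1}},$$ with the same formula for other symmetric matrices in place of $U$ whose blocks on all $\mathrm{fa}(i)$ are positive definite (the determinant of an empty matrix is $1$). Let $\pi^{\Theta_{\mathcal D}}_{U,\alpha}$ be the measure on $\Theta_{\mathcal D}$ with density $$z_{\mathcal D}(U,\alpha)^{-1}\exp\{-\tfrac12\mathrm{tr}(LD^{-1}L^\top U)\}\prod_{i=1}^pD_{ii}^{-\alpha_i/2}$$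 with respect to $\prod_{i}dD_{ii}\prod_{i\in\mathrm{pa}(j)}dL_{ij}$, and let $\pi^{R_{\mathcal D}}_{U,\alpha}$ be its image under $\psi(D,L)=(LD^{-1}L^\top)^E$. Then every $\Upsilon\in R_{\mathcal D}$ has exactly one completion $\widehat\Upsilon\in P_{\mathcal D}$ with $\widehat\Upsilon^E=\Upsilon$, and: (a) $\pi^{R_{\mathcal D}}_{U,\alpha}$ has, with respect to Lebesgue measure on $R_{\mathcal D}\subseteq\mathbb R^{E}$, the density $$z_{\mathcal D}(U,\alpha)^{-1}\exp\{-\tfrac12\mathrm{tr}(\widehat\Upsilon U)\}\prod_{i=1}^pD_{ii}^{-\frac12\alpha_i+pa_i+2},\qquad D_{ii}=(\widehat\Upsilon^{-1})_{ii|\mathrm{pa}(i)}.$$ (b) Let $K$ be a symmetric $p\times p$ matrix such that $(2K+U)_{\mathrm{fa}(i)}$ is positive definite for every $i$ (in particular, any $K$ with $2K+U$ positive definite). Then $\exp\{-\mathrm{tr}(K\widehat\Upsilon)\}$ is integrable and $$\int\exp\{-\mathrm{tr}(K\widehat\Upsilon)\}\,d\pi^{R_{\mathcal D}}_{U,\alpha}(\Upsilon)=\frac{z_{\mathcal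 D}(2K+U,\alpha)}{z_{\mathcal D}(U,\alpha)}.$$ If moreover $K_{ij}=0$ whenever $i\neq j$ are non-adjacent and have a common child (for instance if $K=(K^E)^0$, or for every $K$ if any two parents of a common child are adjacent), then the Laplace transform $\mathcal L(\Gamma)=\int\exp\{-\mathrm{tr}((\Gamma)^0(\Upsilon)^0)\}\,d\pi^{R_{\mathcal D}}_{U,\alpha}(\Upsilon)$ of $\pi^{R_{\mathcal D}}_{U,\alpha}$ at $\Gamma=K^E$ converges and $\mathcal L(K^E)=z_{\mathcal D}(2K+U,\alpha)/z_{\mathcal D}(U,\alpha)$. (c) The mean of $\pi^{R_{\mathcal D}}_{U,\alpha}$ exists and $$\mathbb E(\Upsilon)=\Big(\sum_{j=1}^p(\alpha_j-pa_j-2)\big((U_{\mathrm{fa}(j)})^{-1}\big)^0-\sum_{j=1}^p(\alpha_j-pa_j-3)\big((U_{\mathrm{pa}(j)})^{-1}\big)^0\Big)^E .$$ -/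

import Mathlib

open MeasureTheory ProbabilityTheory
open scoped Matrix

/-- A directed acyclic graph on the vertices `0, …, p - 1`, given in a parent ordering:
`i → j` (that is, `i ∈ pa j`) implies `j < i`. -/
structure OrderedDAG (p : ℕ) where
  /-- the set of parents of a vertex -/
  pa : Fin p → Finset (Fin p)
  lt_of_mem_pa : ∀ i j : Fin p, i ∈ pa j → j < i

namespace OrderedDAG

noncomputable section

variable {p : ℕ} (G : OrderedDAG p)

/-- The family of a vertex: the vertex together with its parents. -/
def fa (j : Fin p) : Finset (Fin p) := insert j (G.pa j)

/-- The number of parents of a vertex, as a real number. -/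
def paCard (j : Fin p) : ℝ := ((G.pa j).card : ℝ)

/-- The arrows `i → j` of the graph, as pairs `(i, j)`. -/
abbrev Arrow : Type := {e : Fin p × Fin p // e.1 ∈ G.pa e.2}

/-- The edge set `E`: the arrows `i → j` together with all the loops `(i, i)`. -/
abbrev Edge : Type := {e : Fin p × Fin p // e.1 ∈ G.fa e.2}

/-! ### Matrices -/

/-- The principal submatrix `A_s` of `A`. -/
def principal (A : Matrix (Fin p) (Fin p) ℝ) (s : Finset (Fin p)) : Matrix s s ℝ :=
  A.submatrix (fun i => i.1) (fun i => i.1)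

/-- The `p × p` matrix `(B)⁰`, which is `B` on `s × s` and zero elsewhere. -/
def zeroPad {s : Finset (Fin p)} (B : Matrix s s ℝ) : Matrix (Fin p) (Fin p) ℝ :=
  Matrix.of fun i j => if h : i ∈ s ∧ j ∈ s then B ⟨i, h.1⟩ ⟨j, h.2⟩ else 0

/-- The Schur complement `A_{ii|pa(i)} = A_{ii} - A_{i,pa(i)} (A_{pa(i)})⁻¹ A_{pa(i),i}`. -/
def schurAt (A : Matrix (Fin p) (Fin p) ℝ) (i : Fin p) : ℝ :=
  A i i - (fun k : G.pa i => A i k.1) ⬝ᵥ ((principal A (G.pa i))⁻¹ *ᵥ fun k : G.pa i => A k.1 i)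

/-! ### The Gaussian model -/

/-- The set `{j : j > i} \ pa(i)`. -/
def nonPa (i : Fin p) : Finset (Fin p) := Finset.univ.filter fun j => i < j ∧ j ∉ G.pa i

/-- The coordinates `x_s` of a vector `x`. -/
def coords (s : Finset (Fin p)) (x : EuclideanSpace ℝ (Fin p)) : s → ℝ := fun k => x k.1

theorem measurable_coords (s : Finset (Fin p)) : Measurable (coords s) := by
  unfold coords; fun_prop

/-- The centred Gaussian distribution `N_p(0, S)` obeys the ordered directed Markov property:
for each `i`, the coordinate `x_i` is independent of the coordinates in `{j : j > i} \ pa(i)`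
conditionally on those in `pa(i)`. -/
def GaussianMarkov (S : Matrix (Fin p) (Fin p) ℝ) : Prop :=
  ∀ i : Fin p, CondIndepFun (MeasurableSpace.comap (coords (G.pa i)) inferInstance)
    (measurable_coords (G.pa i)).comap_le
    (fun x : EuclideanSpace ℝ (Fin p) => x i) (coords (G.nonPa i)) (multivariateGaussian 0 S)

/-- The space `P_G` of precision matrices: the inverses of the positive definite covariance
matrices of the centred Gaussian distributions that are Markov with respect to the graph. -/
def precisionSpace : Set (Matrix (Fin p) (Fin p) ℝ) :=
  {Ω | ∃ S : Matrix (Fin p) (Fin p) ℝ, S.PosDef ∧ G.GaussianMarkov S ∧ Ω = S⁻¹}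

/-! ### Incomplete matrices -/

/-- The space `I_G` of incomplete symmetric matrices, of which only the entries at the edges
are specified. The entries `(i, j)` and `(j, i)` agree, so one of them is stored, the one with
`i ∈ fa(j)`; the Lebesgue measure on `I_G` is the one in these coordinates. -/
abbrev Incomplete : Type := G.Edge → ℝ

/-- The projection `A ↦ A^E` of a symmetric matrix to its entries at the edges. -/
def proj (A : Matrix (Fin p) (Fin p) ℝ) : G.Incomplete := fun e => A e.1.1 e.1.2

/-- The symmetric matrix `(Γ)⁰`, which has the entries of `Γ` at the edges and zeros elsewhere. -/
def zeroFill (Γ : G.Incomplete) : Matrix (Fin p) (Fin p) ℝ :=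
  Matrix.of fun i j =>
    if h : i ∈ G.fa j then Γ ⟨(i, j), h⟩ else if h : j ∈ G.fa i then Γ ⟨(j, i), h⟩ else 0

/-- The space `R_G` of incomplete precision matrices: the incomplete matrices that can be
completed in `P_G`. -/
def incompletePrecision : Set G.Incomplete := {Γ | ∃ Ω ∈ G.precisionSpace, G.proj Ω = Γ}

open Classical in
/-- The completion of an element of `R_G` in `P_G` (and the zero matrix outside `R_G`). -/
def completion (Γ : G.Incomplete) : Matrix (Fin p) (Fin p) ℝ :=
  if h : ∃ Ω ∈ G.precisionSpace, G.proj Ω = Γ then h.choose else 0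

/-! ### The DAG-Wishart distribution -/

/-- Coordinates `(D_{ii})_i` and `(L_{ij})_{i → j}` of a pair `(D, L)`. -/
abbrev CholeskyCoord : Type := (Fin p → ℝ) × (G.Arrow → ℝ)

/-- The Cholesky space `Θ_G`: the entries of the diagonal matrix `D` are positive, those of the
unit lower triangular matrix `L` at the arrows are arbitrary. -/
def choleskySpace : Set G.CholeskyCoord := {θ | ∀ i, 0 < θ.1 i}

/-- The lower triangular matrix `L` with unit diagonal, with the given entries `L_{ij}` for
`i ∈ pa(j)` and zeros elsewhere. -/
def lowerMat (l : G.Arrow → ℝ) : Matrix (Fin p) (Fin p) ℝ :=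
  Matrix.of fun i j => if i = j then 1 else if h : i ∈ G.pa j then l ⟨(i, j), h⟩ else 0

/-- The precision matrix `L D⁻¹ Lᵀ`. -/
def precisionOf (θ : G.CholeskyCoord) : Matrix (Fin p) (Fin p) ℝ :=
  G.lowerMat θ.2 * (Matrix.diagonal θ.1)⁻¹ * (G.lowerMat θ.2)ᵀ

/-- The constant `z_G(U, α)`. -/
def normConst (U : Matrix (Fin p) (Fin p) ℝ) (α : Fin p → ℝ) : ℝ :=
  ∏ i, Real.Gamma (α i / 2 - G.paCard i / 2 - 1) * (2 : ℝ) ^ (α i / 2 - 1) *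
    (Real.sqrt Real.pi) ^ (G.pa i).card *
    (principal U (G.pa i)).det ^ (α i / 2 - G.paCard i / 2 - 3 / 2) /
    (principal U (G.fa i)).det ^ (α i / 2 - G.paCard i / 2 - 1)

/-- The density of the DAG-Wishart distribution on `Θ_G` with respect to `dL dD`. -/
def wishartDensity (U : Matrix (Fin p) (Fin p) ℝ) (α : Fin p → ℝ) (θ : G.CholeskyCoord) : ℝ :=
  (G.normConst U α)⁻¹ * Real.exp (-(1 / 2) * (G.precisionOf θ * U).trace) *
    ∏ i, θ.1 i ^ (-(1 / 2) * α i)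

/-- The DAG-Wishart distribution on `Θ_G`. -/
def wishart (U : Matrix (Fin p) (Fin p) ℝ) (α : Fin p → ℝ) : Measure G.CholeskyCoord :=
  (volume.restrict G.choleskySpace).withDensity fun θ => ENNReal.ofReal (G.wishartDensity U α θ)

/-- The mapping `ψ(D, L) = (L D⁻¹ Lᵀ)^E`. -/
def psi (θ : G.CholeskyCoord) : G.Incomplete := G.proj (G.precisionOf θ)

/-- The DAG-Wishart distribution on `R_G`: the image of the one on `Θ_G` under `ψ`. -/
def wishartR (U : Matrix (Fin p) (Fin p) ℝ) (α : Fin p → ℝ) : Measure G.Incomplete :=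
  (G.wishart U α).map G.psi

/-- The Laplace transform at `Γ` of a measure on `I_G`, for the inner product
`⟨Γ, Υ⟩ = tr((Γ)⁰ (Υ)⁰)`. -/
def laplace (μ : Measure G.Incomplete) (Γ : G.Incomplete) : ℝ :=
  ∫ Υ, Real.exp (-(G.zeroFill Γ * G.zeroFill Υ).trace) ∂μ

end

end OrderedDAG

/-! For a centred Gaussian vector with covariance `S`, let the `i`-th column of a unit lower
triangular `L` hold minus the regression coefficients of `x_i` on its parents. Then `(Lᵀ x)_i` is
the regression residual, and the Markov property says that it is uncorrelated with every `x_k`, `k >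
i`: row `i` of `Lᵀ S` vanishes to the right of the diagonal. Hence `Lᵀ S L` is lower triangular and
symmetric, so it is a diagonal matrix `D`, and the precision matrices are exactly the products `L
D⁻¹ Lᵀ` (`precisionSpace_eq_image`).

In column `j`, an entry of `L D⁻¹ Lᵀ` at an edge is `L_ij / D_j` plus terms from earlier columns. So
the edge entries determine `(D, L)` column by column (`psi_injOn`), which gives the unique
completion. For the same reason the derivative of `psi` is triangular, with absolute determinant `∏
D_j ^ (-(pa_j + 2))` (`abs_det_psiDeriv`). This factor accounts for the change of exponent in (a).

For symmetric `V`, `tr(L D⁻¹ Lᵀ V) = ∑ D_j⁻¹ (Lᵀ V L)_jj`, and the `j`-th term involves only `D_j`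
and the `j`-th column of `L`. The normalizing integral therefore splits over the vertices into a
Gaussian integral followed by an inverse gamma integral (`lintegral_columnKernel`). Only the family
blocks of `V` have to be positive definite. Multiplying the density by `exp(-tr(K Ω))` replaces `U`
by `2K + U`, which gives (b).

For (c), the moment generating function of `tr(K Ω)` near zero is a ratio of normalizing constants.
It is differentiated with Jacobi's formula for the determinant, and suitable symmetric `K` extract
the entries of the mean. -/

/-! ### Conditional independence in terms of a residual -/

section CondIndep

variable {Ω 𝓧 𝓨 𝓩 : Type*} [MeasurableSpace Ω] [MeasurableSpace 𝓧]
  [MeasurableSpace 𝓨] [MeasurableSpace 𝓩]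

/-- The kernel which sends `x` to the law of `R + φ x` if `R` has law `ν`. -/
noncomputable def shiftKernel (ν : Measure ℝ) (φ : 𝓧 → ℝ) (hφ : Measurable φ) : Kernel 𝓧 ℝ :=
  (Kernel.const 𝓧 ν ×ₖ Kernel.deterministic φ hφ).map (fun q => q.1 + q.2)

instance (ν : Measure ℝ) [IsProbabilityMeasure ν] (φ : 𝓧 → ℝ) (hφ : Measurable φ) :
    IsMarkovKernel (shiftKernel ν φ hφ) := by
  unfold shiftKernel
  exact Kernel.IsMarkovKernel.map _ (by fun_prop)

theorem lintegral_shiftKernel (ν : Measure ℝ) [IsProbabilityMeasure ν] (φ : 𝓧 → ℝ)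
    (hφ : Measurable φ) (x : 𝓧) {f : ℝ → ENNReal} (hf : Measurable f) :
    ∫⁻ y, f y ∂(shiftKernel ν φ hφ x) = ∫⁻ r, f (r + φ x) ∂ν := by
  rw [shiftKernel, Kernel.lintegral_map _ (by fun_prop) _ hf,
    Kernel.lintegral_prod _ _ _ (by fun_prop)]
  simp only [Kernel.const_apply, Kernel.deterministic_apply]
  congr 1; ext r
  rw [lintegral_dirac' _ (by fun_prop)]

theorem compProd_shiftKernel (μ : Measure 𝓧) [SFinite μ] (ν : Measure ℝ) [IsProbabilityMeasure ν]
    (φ : 𝓧 → ℝ) (hφ : Measurable φ) :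
    μ ⊗ₘ shiftKernel ν φ hφ = (μ.prod ν).map (fun q => (q.1, q.2 + φ q.1)) := by
  refine Measure.ext_of_lintegral _ fun f hf => ?_
  rw [Measure.lintegral_compProd hf, lintegral_map hf (by fun_prop),
    lintegral_prod _ (by fun_prop)]
  congr 1; ext x
  rw [lintegral_shiftKernel _ _ _ _ (by fun_prop)]

/-- The shear `(x, r) ↦ (x, r + φ x)` is invertible and carries the product of the two laws to the
right-hand side, so joint laws may be compared before or after it. -/
theorem indepFun_iff_map_eq_compProd_shiftKernel {μ : Measure Ω} [IsProbabilityMeasure μ]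
    {R : Ω → ℝ} {X : Ω → 𝓧} (hR : Measurable R) (hX : Measurable X) {φ : 𝓧 → ℝ}
    (hφ : Measurable φ) :
    IndepFun X R μ ↔
      μ.map (fun ω => (X ω, R ω + φ (X ω))) = μ.map X ⊗ₘ shiftKernel (μ.map R) φ hφ := by
  have := Measure.isProbabilityMeasure_map (μ := μ) hR.aemeasurable
  have := Measure.isProbabilityMeasure_map (μ := μ) hX.aemeasurable
  rw [indepFun_iff_map_prod_eq_prod_map_map hX.aemeasurable hR.aemeasurable, compProd_shiftKernel]
  have key : μ.map (fun ω => (X ω, R ω + φ (X ω)))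
      = (μ.map fun ω => (X ω, R ω)).map (fun q => (q.1, q.2 + φ q.1)) := by
    rw [Measure.map_map (by fun_prop) (by fun_prop)]; rfl
  rw [key]
  refine ⟨fun h => by rw [h], fun h => ?_⟩
  have h2 := congrArg (Measure.map (fun q : 𝓧 × ℝ => (q.1, q.2 - φ q.1))) h
  rw [Measure.map_map (by fun_prop) (by fun_prop), Measure.map_map (by fun_prop) (by fun_prop),
    Measure.map_map (by fun_prop) (by fun_prop)] at h2
  have : (fun q : 𝓧 × ℝ => (q.1, q.2 - φ q.1)) ∘ (fun q => (q.1, q.2 + φ q.1)) = id := by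
    ext q <;> simp
  rw [this, Measure.map_id] at h2
  rw [← h2]
  rfl

/-- Since `R` is independent of `Y`, the conditional law of `R + φ(Y)` given `Y` is the law of `R`
shifted by `φ(Y)`. Conditional independence from `Z` means that conditioning on `(Y, Z)` gives the
same kernel; by the shear criterion this is independence of `R` from the pair. -/
theorem condIndepFun_add_iff_indepFun [StandardBorelSpace Ω] [StandardBorelSpace 𝓩] [Nonempty 𝓩]
    {μ : Measure Ω} [IsProbabilityMeasure μ]
    {R : Ω → ℝ} {Y : Ω → 𝓨} {Z : Ω → 𝓩} (hR : Measurable R) (hY : Measurable Y) (hZ : Measurable Z)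
    {φ : 𝓨 → ℝ} (hφ : Measurable φ) (hRY : IndepFun Y R μ) :
    CondIndepFun (MeasurableSpace.comap Y inferInstance) hY.comap_le
      (fun ω => R ω + φ (Y ω)) Z μ ↔ IndepFun (fun ω => (Y ω, Z ω)) R μ := by
  have := Measure.isProbabilityMeasure_map (μ := μ) hR.aemeasurable
  have hm : Measurable (fun ω => R ω + φ (Y ω)) := by fun_prop
  have h1 := condDistrib_ae_eq_of_measure_eq_compProd (μ := μ) Y hm.aemeasurable
    ((indepFun_iff_map_eq_compProd_shiftKernel hR hY hφ).1 hRY)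
  have h2 : (condDistrib (fun ω => R ω + φ (Y ω)) Y μ).prodMkRight 𝓩
      =ᵐ[μ.map (fun ω => (Y ω, Z ω))]
      shiftKernel (μ.map R) (fun q : 𝓨 × 𝓩 => φ q.1) (by fun_prop) := by
    have : μ.map Y = (μ.map (fun ω => (Y ω, Z ω))).map Prod.fst := by
      rw [Measure.map_map (by fun_prop) (by fun_prop)]; rfl
    rw [this] at h1
    filter_upwards [ae_of_ae_map measurable_fst.aemeasurable h1] with q hq
    rw [Kernel.prodMkRight_apply, hq]
    refine Measure.ext_of_lintegral _ fun f hf => ?_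
    rw [lintegral_shiftKernel _ _ _ _ hf, lintegral_shiftKernel _ _ _ _ hf]
  have h3 := condIndepFun_iff_condDistrib_prod_ae_eq_prodMkRight (μ := μ) hm hZ hY
  rw [indepFun_iff_map_eq_compProd_shiftKernel (φ := fun q : 𝓨 × 𝓩 => φ q.1) hR (by fun_prop)
    (by fun_prop), ← condDistrib_ae_eq_iff_measure_eq_compProd _ hm.aemeasurable]
  constructor
  · intro h
    exact (h3.1 h.symm).trans h2
  · intro h
    exact (h3.2 (h.trans h2.symm)).symm

end CondIndep

/-! ### The Gaussian Markov property as linear equations -/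

namespace OrderedDAG
noncomputable section
variable {p : ℕ} (G : OrderedDAG p)

theorem covariance_linear_multivariateGaussian {S : Matrix (Fin p) (Fin p) ℝ} (hS : S.PosSemidef)
    (c : Fin p → ℝ) (k : Fin p) :
    cov[fun x : EuclideanSpace ℝ (Fin p) => ∑ j, c j * x j, fun x => x k;
      multivariateGaussian 0 S] = ∑ j, c j * S j k := by
  have hL : ∀ j, MemLp (fun x : EuclideanSpace ℝ (Fin p) => x j) 2 (multivariateGaussian 0 S) :=
    fun j => (IsGaussian.hasGaussianLaw_id.map_fun (EuclideanSpace.proj (𝕜 := ℝ) j)).memLp_two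
  rw [covariance_fun_sum_left (fun j => (hL j).const_mul (c j)) (hL k)]
  refine Finset.sum_congr rfl fun j _ => ?_
  rw [covariance_const_mul_left, covariance_eval_multivariateGaussian hS]

/-- Jointly Gaussian families with zero cross-covariances are independent; the linear form is
treated as a family indexed by `Unit`. -/
theorem indepFun_coords_linear {S : Matrix (Fin p) (Fin p) ℝ} (hS : S.PosSemidef)
    (c : Fin p → ℝ) (s : Finset (Fin p)) (h : ∀ k ∈ s, ∑ j, c j * S j k = 0) :
    IndepFun (coords s) (fun x : EuclideanSpace ℝ (Fin p) => ∑ j, c j * x j)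
      (multivariateGaussian 0 S) := by
  let A : EuclideanSpace ℝ (Fin p) →L[ℝ] (s → ℝ) × (Unit → ℝ) :=
    ContinuousLinearMap.prod (ContinuousLinearMap.pi fun k => EuclideanSpace.proj (𝕜 := ℝ) k.1)
      (ContinuousLinearMap.pi fun _ => ∑ j, c j • EuclideanSpace.proj (𝕜 := ℝ) j)
  have hG := (IsGaussian.hasGaussianLaw_id (μ := multivariateGaussian 0 S)).map_fun A
  have := HasGaussianLaw.indepFun_of_covariance_eval (P := multivariateGaussian 0 S)
    (X := fun (k : s) x => x k.1) (Y := fun (_ : Unit) x => ∑ j, c j * x j)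
    (hG.congr (Filter.Eventually.of_forall fun x => by ext <;> simp [A])) (by
      intro k _
      rw [covariance_comm, covariance_linear_multivariateGaussian hS, h _ k.2])
  exact this.comp measurable_id (measurable_pi_apply ())

theorem sum_lowerMat_mul (l : G.Arrow → ℝ) (i : Fin p) (v : Fin p → ℝ) :
    ∑ j, G.lowerMat l j i * v j = v i + ∑ m : G.pa i, l ⟨(m.1, i), m.2⟩ * v m.1 := by
  have hi : i ∉ G.pa i := fun h => lt_irrefl _ (G.lt_of_mem_pa _ _ h)
  rw [← Finset.add_sum_erase _ _ (Finset.mem_univ i)]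
  congr 1
  · simp [lowerMat]
  · rw [← Finset.sum_subset (s₁ := G.pa i), ← Finset.sum_attach]
    · refine Finset.sum_congr rfl fun m _ => ?_
      have : m.1 ≠ i := fun h => hi (by simpa [h] using m.2)
      simp [lowerMat, this]
    · intro m hm
      have : m ≠ i := by rintro rfl; exact hi hm
      simpa using this
    · intro m hm hm'
      simp [lowerMat, hm', (Finset.mem_erase.1 hm).1]

/-- The hypothesis makes `(Lᵀ x)_i` uncorrelated with the parents, so it is the regression residual
and the residual criterion applies. Independence of the residual from parents and non-parents
together is vanishing covariance with all later coordinates. -/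
theorem condIndepFun_iff_of_forall_mem_pa {S : Matrix (Fin p) (Fin p) ℝ} (hS : S.PosSemidef)
    (l : G.Arrow → ℝ) (i : Fin p) (h : ∀ k ∈ G.pa i, ((G.lowerMat l)ᵀ * S) i k = 0) :
    CondIndepFun (MeasurableSpace.comap (coords (G.pa i)) inferInstance)
      (measurable_coords (G.pa i)).comap_le
      (fun x : EuclideanSpace ℝ (Fin p) => x i) (coords (G.nonPa i)) (multivariateGaussian 0 S) ↔
    ∀ k, i < k → ((G.lowerMat l)ᵀ * S) i k = 0 := by
  let R : EuclideanSpace ℝ (Fin p) → ℝ := fun x => ∑ j, G.lowerMat l j i * x j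
  let φ : (G.pa i → ℝ) → ℝ := fun y => - ∑ m, l ⟨(m.1, i), m.2⟩ * y m
  have hR : Measurable R := by fun_prop
  have hφ : Measurable φ := by fun_prop
  have hx : (fun x : EuclideanSpace ℝ (Fin p) => x i) = fun x => R x + φ (coords (G.pa i) x) := by
    ext x; simp [R, φ, G.sum_lowerMat_mul l i, coords]
  have hcov : ∀ k, ((G.lowerMat l)ᵀ * S) i k = ∑ j, G.lowerMat l j i * S j k := fun k => by
    simp [Matrix.mul_apply]
  rw [hx, condIndepFun_add_iff_indepFun hR (measurable_coords _) (measurable_coords _) hφ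
    (indepFun_coords_linear hS _ _ fun k hk => by rw [← hcov, h k hk])]
  constructor
  · intro hI k hk
    rw [hcov, ← covariance_linear_multivariateGaussian hS, covariance_comm]
    have hi : IndepFun (fun x : EuclideanSpace ℝ (Fin p) => x k) R (multivariateGaussian 0 S) := by
      by_cases hkp : k ∈ G.pa i
      · exact hI.comp (φ := fun q : (G.pa i → ℝ) × (G.nonPa i → ℝ) => q.1 ⟨k, hkp⟩) (by fun_prop) measurable_id
      · exact hI.comp (φ := fun q : (G.pa i → ℝ) × (G.nonPa i → ℝ) => q.2 ⟨k, by simp [nonPa, hk, hkp]⟩) (by fun_prop) measurable_id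
    refine hi.covariance_eq_zero ?_ ?_
    · exact (IsGaussian.hasGaussianLaw_id.map_fun (EuclideanSpace.proj (𝕜 := ℝ) k)).memLp_two
    · convert ((IsGaussian.hasGaussianLaw_id (μ := multivariateGaussian 0 S)).map_fun
        (∑ j, G.lowerMat l j i • EuclideanSpace.proj (𝕜 := ℝ) j)).memLp_two using 1
      ext x; simp [R]
  · intro hz
    have := indepFun_coords_linear hS (fun j => G.lowerMat l j i) (Finset.univ.filter (i < ·))
      fun k hk => by rw [← hcov, hz k (by simpa using hk)]
    -- The vertices after `i` include both `pa i` and `nonPa i`, so both coordinate vectors are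
    -- functions of the one already shown independent.
    exact this.comp (φ := fun q : (Finset.univ.filter (i < ·) → ℝ) => (fun m : G.pa i => q ⟨m.1, by simpa using G.lt_of_mem_pa _ _ m.2⟩,
      fun m : G.nonPa i => q ⟨m.1, by have := m.2; simp [nonPa] at this; simpa using this.1⟩))
      (by fun_prop) measurable_id

theorem principal_posDef {S : Matrix (Fin p) (Fin p) ℝ} (hS : S.PosDef) (s : Finset (Fin p)) :
    (principal S s).PosDef := hS.submatrix Subtype.val_injective

/-- These are the normal equations of the regression on the parents, solvable because `S_pa` is
invertible. -/
theorem exists_lowerMat_transpose_mul_eq_zero {S : Matrix (Fin p) (Fin p) ℝ} (hS : S.PosDef) :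
    ∃ l : G.Arrow → ℝ, ∀ i, ∀ k ∈ G.pa i, ((G.lowerMat l)ᵀ * S) i k = 0 := by
  refine ⟨fun e => -((fun m : G.pa e.1.2 => S e.1.2 m.1) ᵥ* (principal S (G.pa e.1.2))⁻¹) ⟨e.1.1, e.2⟩,
    fun i k hk => ?_⟩
  rw [Matrix.mul_apply]
  simp only [Matrix.transpose_apply]
  rw [G.sum_lowerMat_mul]
  have hu := (principal_posDef hS (G.pa i)).isUnit
  have h1 : ((fun m : G.pa i => S i m.1) ᵥ* (principal S (G.pa i))⁻¹) ᵥ* principal S (G.pa i)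
      = fun m : G.pa i => S i m.1 := by
    rw [Matrix.vecMul_vecMul, Matrix.nonsing_inv_mul _ ((Matrix.isUnit_iff_isUnit_det _).1 hu),
      Matrix.vecMul_one]
  have h2 := congrFun h1 ⟨k, hk⟩
  simp only [Matrix.vecMul, dotProduct, principal, Matrix.submatrix_apply] at h2 ⊢
  simp only [neg_mul, Finset.sum_neg_distrib]
  rw [h2]; ring

theorem gaussianMarkov_iff {S : Matrix (Fin p) (Fin p) ℝ} (hS : S.PosDef) :
    G.GaussianMarkov S ↔ ∃ l : G.Arrow → ℝ, ∀ i k, i < k → ((G.lowerMat l)ᵀ * S) i k = 0 := by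
  constructor
  · intro h
    obtain ⟨l, hl⟩ := G.exists_lowerMat_transpose_mul_eq_zero hS
    exact ⟨l, fun i => (G.condIndepFun_iff_of_forall_mem_pa hS.posSemidef l i (hl i)).1 (h i)⟩
  · rintro ⟨l, hl⟩ i
    exact (G.condIndepFun_iff_of_forall_mem_pa hS.posSemidef l i
      fun k hk => hl i k (G.lt_of_mem_pa _ _ hk)).2 (hl i)

end
end OrderedDAG

/-! ### Cholesky parametrization and unique completion -/

namespace OrderedDAG
noncomputable section
variable {p : ℕ} (G : OrderedDAG p)

@[simp] theorem lowerMat_diag (l : G.Arrow → ℝ) (i : Fin p) : G.lowerMat l i i = 1 := by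
  simp [lowerMat]

theorem lowerMat_eq_zero_of_lt (l : G.Arrow → ℝ) {i j : Fin p} (h : i < j) :
    G.lowerMat l i j = 0 := by
  have h1 : i ∉ G.pa j := fun h' => lt_asymm h (G.lt_of_mem_pa _ _ h')
  simp [lowerMat, h.ne, h1]

theorem lowerMat_eq_zero_of_notMem_fa (l : G.Arrow → ℝ) {i j : Fin p} (h : i ∉ G.fa j) :
    G.lowerMat l i j = 0 := by
  simp only [fa, Finset.mem_insert, not_or] at h
  simp [lowerMat, h.1, h.2]

theorem lowerMat_blockTriangular (l : G.Arrow → ℝ) :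
    (G.lowerMat l).BlockTriangular OrderDual.toDual :=
  fun _ _ h => G.lowerMat_eq_zero_of_lt l (OrderDual.toDual_lt_toDual.1 h)

@[simp] theorem det_lowerMat (l : G.Arrow → ℝ) : (G.lowerMat l).det = 1 := by
  rw [Matrix.det_of_isLowerTriangular _ (G.lowerMat_blockTriangular l)]
  simp

theorem isUnit_lowerMat (l : G.Arrow → ℝ) : IsUnit (G.lowerMat l) := by
  rw [Matrix.isUnit_iff_isUnit_det]; simp

theorem inv_diagonal_of_mem {d : Fin p → ℝ} (hd : ∀ i, 0 < d i) :
    (Matrix.diagonal d)⁻¹ = Matrix.diagonal fun i => (d i)⁻¹ := by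
  refine Matrix.inv_eq_left_inv ?_
  rw [Matrix.diagonal_mul_diagonal, ← Matrix.diagonal_one]
  congr 1; ext i; exact inv_mul_cancel₀ (hd i).ne'

theorem precisionOf_apply {θ : G.CholeskyCoord} (hθ : θ ∈ G.choleskySpace) (i j : Fin p) :
    G.precisionOf θ i j = ∑ k, G.lowerMat θ.2 i k * (θ.1 k)⁻¹ * G.lowerMat θ.2 j k := by
  rw [precisionOf, inv_diagonal_of_mem hθ, Matrix.mul_apply]
  simp [Matrix.mul_diagonal]

theorem precisionOf_isSymm {θ : G.CholeskyCoord} (hθ : θ ∈ G.choleskySpace) :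
    (G.precisionOf θ).IsSymm := by
  ext i j
  rw [Matrix.transpose_apply, G.precisionOf_apply hθ, G.precisionOf_apply hθ]
  exact Finset.sum_congr rfl fun k _ => by ring

theorem precisionOf_posDef {θ : G.CholeskyCoord} (hθ : θ ∈ G.choleskySpace) :
    (G.precisionOf θ).PosDef := by
  rw [precisionOf, inv_diagonal_of_mem hθ]
  have h := Matrix.PosDef.mul_mul_conjTranspose_same (A := Matrix.diagonal fun i => (θ.1 i)⁻¹)
    (B := G.lowerMat θ.2) (Matrix.posDef_diagonal_iff.2 fun i => inv_pos.2 (hθ i))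
    (Matrix.vecMul_injective_of_isUnit (G.isUnit_lowerMat θ.2))
  simpa using h

theorem transpose_mul_inv_precisionOf_mul {θ : G.CholeskyCoord} (hθ : θ ∈ G.choleskySpace) :
    (G.lowerMat θ.2)ᵀ * (G.precisionOf θ)⁻¹ * G.lowerMat θ.2 = Matrix.diagonal θ.1 := by
  have hL := G.isUnit_lowerMat θ.2
  have hLd : IsUnit (G.lowerMat θ.2).det := (Matrix.isUnit_iff_isUnit_det _).1 hL
  have hLt : IsUnit (G.lowerMat θ.2)ᵀ.det := by simp
  have hD : IsUnit (Matrix.diagonal θ.1).det := by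
    rw [Matrix.det_diagonal]; exact (Finset.prod_ne_zero_iff.2 fun i _ => (hθ i).ne').isUnit
  rw [precisionOf, Matrix.mul_inv_rev, Matrix.mul_inv_rev, Matrix.nonsing_inv_nonsing_inv _ hD,
    Matrix.mul_nonsing_inv_cancel_left _ _ hLt, Matrix.mul_assoc, Matrix.nonsing_inv_mul _ hLd,
    Matrix.mul_one]

theorem transpose_mul_inv_precisionOf {θ : G.CholeskyCoord} (hθ : θ ∈ G.choleskySpace) :
    (G.lowerMat θ.2)ᵀ * (G.precisionOf θ)⁻¹ = Matrix.diagonal θ.1 * (G.lowerMat θ.2)⁻¹ := by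
  have hLd : IsUnit (G.lowerMat θ.2).det := by simp
  rw [← G.transpose_mul_inv_precisionOf_mul hθ, Matrix.mul_nonsing_inv_cancel_right _ _ hLd]

/-- `Lᵀ Ω⁻¹ = D L⁻¹` is lower triangular; this is the Markov property of `Ω⁻¹` in matrix form. -/
theorem transpose_mul_inv_precisionOf_apply {θ : G.CholeskyCoord} (hθ : θ ∈ G.choleskySpace)
    {i k : Fin p} (h : i < k) : ((G.lowerMat θ.2)ᵀ * (G.precisionOf θ)⁻¹) i k = 0 := by
  rw [G.transpose_mul_inv_precisionOf hθ, Matrix.diagonal_mul]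
  let := (G.isUnit_lowerMat θ.2).invertible
  rw [Matrix.blockTriangular_inv_of_blockTriangular (G.lowerMat_blockTriangular θ.2)
    (OrderDual.toDual_lt_toDual.2 h), mul_zero]

theorem transpose_mul_inv_precisionOf_diag {θ : G.CholeskyCoord} (hθ : θ ∈ G.choleskySpace)
    (i : Fin p) : ((G.lowerMat θ.2)ᵀ * (G.precisionOf θ)⁻¹) i i = θ.1 i := by
  have h := congrFun (congrFun (G.transpose_mul_inv_precisionOf_mul hθ) i) i
  rw [Matrix.diagonal_apply_eq, Matrix.mul_apply, Finset.sum_eq_single i] at h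
  · simpa using h
  · intro j _ hj
    rcases lt_or_gt_of_ne hj with hj | hj
    · rw [G.lowerMat_eq_zero_of_lt _ hj, mul_zero]
    · rw [G.transpose_mul_inv_precisionOf_apply hθ hj, zero_mul]
  · simp

/-- The vanishing of row `i` of `Lᵀ S` at the parents identifies column `i` of `L` with minus the
regression coefficients. Its diagonal entry is then both the residual variance and `D_ii`. -/
theorem schurAt_inv_precisionOf {θ : G.CholeskyCoord} (hθ : θ ∈ G.choleskySpace) (i : Fin p) :
    G.schurAt (G.precisionOf θ)⁻¹ i = θ.1 i := by
  set S := (G.precisionOf θ)⁻¹ with hSdef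
  have hS : S.PosDef := (G.precisionOf_posDef hθ).inv
  have hrow : ∀ k, ((G.lowerMat θ.2)ᵀ * S) i k
      = S i k + ∑ m : G.pa i, θ.2 ⟨(m.1, i), m.2⟩ * S m.1 k := fun k => by
    rw [Matrix.mul_apply]; exact G.sum_lowerMat_mul θ.2 i fun j => S j k
  have hpa : (fun k : G.pa i => S i k.1)
      = (fun m : G.pa i => - θ.2 ⟨(m.1, i), m.2⟩) ᵥ* principal S (G.pa i) := by
    ext k
    have h := G.transpose_mul_inv_precisionOf_apply hθ (G.lt_of_mem_pa _ _ k.2)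
    rw [← hSdef, hrow] at h
    simp only [Matrix.vecMul, dotProduct, principal, Matrix.submatrix_apply, neg_mul,
      Finset.sum_neg_distrib]
    linarith
  have hu : IsUnit (principal S (G.pa i)).det :=
    (Matrix.isUnit_iff_isUnit_det _).1 (principal_posDef hS (G.pa i)).isUnit
  have hd := G.transpose_mul_inv_precisionOf_diag hθ i
  rw [← hSdef, hrow] at hd
  rw [schurAt, hpa, Matrix.dotProduct_mulVec, Matrix.vecMul_vecMul, Matrix.mul_nonsing_inv _ hu,
    Matrix.vecMul_one, ← hd]
  simp [dotProduct]

theorem precisionSpace_eq_image : G.precisionSpace = G.precisionOf '' G.choleskySpace := by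
  ext Ω
  constructor
  · rintro ⟨S, hS, hM, rfl⟩
    obtain ⟨l, hl⟩ := (G.gaussianMarkov_iff hS).1 hM
    set L := G.lowerMat l with hL
    have hLd : IsUnit L.det := by simp [hL]
    have hLt : IsUnit Lᵀ.det := by simpa using hLd
    set M := Lᵀ * S * L with hMdef
    have hMp : M.PosDef := by
      have := hS.conjTranspose_mul_mul_same (B := L)
        (Matrix.mulVec_injective_of_isUnit (G.isUnit_lowerMat l))
      simpa using this
    have hlt : ∀ i k, i < k → M i k = 0 := by
      intro i k hik
      rw [hMdef, Matrix.mul_apply]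
      refine Finset.sum_eq_zero fun j _ => ?_
      rcases lt_or_ge i j with hij | hij
      · rw [hl i j hij, zero_mul]
      · rw [hL, G.lowerMat_eq_zero_of_lt l (hij.trans_lt hik), mul_zero]
    -- `M` is symmetric and lower triangular, hence diagonal.
    have hMd : M = Matrix.diagonal fun i => M i i := by
      ext i k
      rcases lt_trichotomy i k with h | h | h
      · rw [hlt i k h, Matrix.diagonal_apply_ne _ h.ne]
      · rw [h, Matrix.diagonal_apply_eq]
      · rw [Matrix.diagonal_apply_ne _ h.ne']
        have := hMp.isHermitian.apply i k
        rw [← this, hlt k i h]; simp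
    refine ⟨(fun i => M i i, l), fun i => hMp.diag_pos, ?_⟩
    simp only [precisionOf]
    rw [← hMd, ← hL, hMdef, Matrix.mul_inv_rev, Matrix.mul_inv_rev,
      Matrix.mul_nonsing_inv_cancel_left _ _ hLd, Matrix.mul_assoc, Matrix.nonsing_inv_mul _ hLt,
      Matrix.mul_one]
  · rintro ⟨θ, hθ, rfl⟩
    have hP := G.precisionOf_posDef hθ
    refine ⟨(G.precisionOf θ)⁻¹, hP.inv, (G.gaussianMarkov_iff hP.inv).2
      ⟨θ.2, fun i k => G.transpose_mul_inv_precisionOf_apply hθ⟩, ?_⟩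
    rw [Matrix.nonsing_inv_nonsing_inv _ ((Matrix.isUnit_iff_isUnit_det _).1 hP.isUnit)]

/-- The part of `(L D⁻¹ Lᵀ)_{ij}` which comes from the columns before the `j`-th one. -/
def psiTail (θ : G.CholeskyCoord) (i j : Fin p) : ℝ :=
  ∑ k ∈ Finset.univ.filter (· < j), G.lowerMat θ.2 i k * (θ.1 k)⁻¹ * G.lowerMat θ.2 j k

theorem precisionOf_eq_add_psiTail {θ : G.CholeskyCoord} (hθ : θ ∈ G.choleskySpace)
    (i j : Fin p) :
    G.precisionOf θ i j = G.lowerMat θ.2 i j * (θ.1 j)⁻¹ + G.psiTail θ i j := by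
  rw [G.precisionOf_apply hθ, psiTail, ← Finset.sum_filter_add_sum_filter_not _ (· < j), add_comm]
  congr 1
  rw [Finset.sum_eq_single j]
  · simp
  · intro k hk hkj
    simp only [Finset.mem_filter, Finset.mem_univ, true_and, not_lt] at hk
    rw [G.lowerMat_eq_zero_of_lt _ (lt_of_le_of_ne hk hkj.symm), mul_zero]
  · simp

theorem mem_fa_self (j : Fin p) : j ∈ G.fa j := Finset.mem_insert_self _ _

/-- Induction over columns: once the columns before `j` agree, so do the tails. The loop then gives
`D_j`, since `L_jj = 1`, and the arrows give the entries `L_ij`. -/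
theorem psi_injOn : Set.InjOn G.psi G.choleskySpace := by
  intro θ hθ θ' hθ' h
  have key : ∀ j, θ.1 j = θ'.1 j ∧ ∀ i, G.lowerMat θ.2 i j = G.lowerMat θ'.2 i j := by
    intro j
    induction j using WellFoundedLT.induction with
    | ind j ih =>
      have ht : ∀ i, G.psiTail θ i j = G.psiTail θ' i j := by
        intro i
        refine Finset.sum_congr rfl fun k hk => ?_
        have := ih k (by simpa using hk)
        rw [this.1, this.2 i, this.2 j]
      have he : ∀ i ∈ G.fa j,
          G.lowerMat θ.2 i j * (θ.1 j)⁻¹ = G.lowerMat θ'.2 i j * (θ'.1 j)⁻¹ := by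
        intro i hi
        have := congrFun h ⟨(i, j), hi⟩
        simp only [psi, proj] at this
        rw [G.precisionOf_eq_add_psiTail hθ, G.precisionOf_eq_add_psiTail hθ', ht i] at this
        linarith
      have hD : θ.1 j = θ'.1 j := by simpa using he j (G.mem_fa_self j)
      refine ⟨hD, fun i => ?_⟩
      by_cases hi : i ∈ G.fa j
      · have := he i hi
        rw [hD] at this
        exact mul_right_cancel₀ (inv_ne_zero (hθ' j).ne') this
      · rw [G.lowerMat_eq_zero_of_notMem_fa _ hi, G.lowerMat_eq_zero_of_notMem_fa _ hi]
  refine Prod.ext (funext fun j => (key j).1) (funext fun e => ?_)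
  have := (key e.1.2).2 e.1.1
  have hne : e.1.1 ≠ e.1.2 := (G.lt_of_mem_pa _ _ e.2).ne'
  simpa [lowerMat, hne, e.2] using this

theorem incompletePrecision_eq_image : G.incompletePrecision = G.psi '' G.choleskySpace := by
  ext Υ
  rw [incompletePrecision, precisionSpace_eq_image]
  constructor
  · rintro ⟨_, ⟨θ, hθ, rfl⟩, rfl⟩
    exact ⟨θ, hθ, rfl⟩
  · rintro ⟨θ, hθ, rfl⟩
    exact ⟨_, ⟨θ, hθ, rfl⟩, rfl⟩

theorem existsUnique_completion {Υ : G.Incomplete} (h : Υ ∈ G.incompletePrecision) :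
    ∃! Ω, Ω ∈ G.precisionSpace ∧ G.proj Ω = Υ := by
  obtain ⟨Ω, hΩ, he⟩ := h
  refine ⟨Ω, ⟨hΩ, he⟩, ?_⟩
  rintro Ω' ⟨hΩ', he'⟩
  rw [precisionSpace_eq_image] at hΩ hΩ'
  obtain ⟨θ, hθ, rfl⟩ := hΩ
  obtain ⟨θ', hθ', rfl⟩ := hΩ'
  rw [G.psi_injOn hθ hθ' (he.trans he'.symm)]

theorem completion_psi {θ : G.CholeskyCoord} (hθ : θ ∈ G.choleskySpace) :
    G.completion (G.psi θ) = G.precisionOf θ := by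
  have hmem : G.precisionOf θ ∈ G.precisionSpace := by
    rw [precisionSpace_eq_image]; exact ⟨θ, hθ, rfl⟩
  have h : ∃ Ω ∈ G.precisionSpace, G.proj Ω = G.psi θ := ⟨_, hmem, rfl⟩
  rw [completion, dif_pos h]
  exact (G.existsUnique_completion h).unique h.choose_spec ⟨hmem, rfl⟩

end
end OrderedDAG

/-! ### The Jacobian of the parametrization -/

namespace OrderedDAG
noncomputable section
variable {p : ℕ} (G : OrderedDAG p)

theorem mem_fa_of_mem_pa {i j : Fin p} (h : i ∈ G.pa j) : i ∈ G.fa j :=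
  Finset.mem_insert_of_mem h

theorem le_of_mem_fa {i j : Fin p} (h : i ∈ G.fa j) : j ≤ i := by
  rcases Finset.mem_insert.1 h with rfl | h
  · exact le_rfl
  · exact (G.lt_of_mem_pa _ _ h).le

/-- The loop at a vertex, as an edge. -/
def loop (i : Fin p) : G.Edge := ⟨(i, i), G.mem_fa_self i⟩

/-- An arrow, as an edge. -/
def arrowEdge (a : G.Arrow) : G.Edge := ⟨a.1, G.mem_fa_of_mem_pa a.2⟩

/-- The edges are the loops and the arrows. -/
def edgeEquiv : Fin p ⊕ G.Arrow ≃ G.Edge :=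
  Equiv.ofBijective (Sum.elim G.loop G.arrowEdge) (by
    have hne : ∀ a : G.Arrow, a.1.1 ≠ a.1.2 := fun a => (G.lt_of_mem_pa _ _ a.2).ne'
    constructor
    · rintro (i | a) (j | b) h
      · simp only [Sum.elim_inl, loop, Subtype.mk.injEq, Prod.mk.injEq] at h
        rw [h.1]
      · simp only [Sum.elim_inl, Sum.elim_inr, loop, arrowEdge, Subtype.mk.injEq] at h
        exact absurd (by rw [← h]) (hne b)
      · simp only [Sum.elim_inl, Sum.elim_inr, loop, arrowEdge, Subtype.mk.injEq] at h
        exact absurd (by rw [h]) (hne a)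
      · simp only [Sum.elim_inr, arrowEdge, Subtype.mk.injEq] at h
        rw [Subtype.ext h]
    · rintro ⟨⟨i, j⟩, h⟩
      rcases Finset.mem_insert.1 h with h' | h'
      · exact ⟨Sum.inl j, by simp only at h'; simp [loop, h']⟩
      · exact ⟨Sum.inr ⟨(i, j), h'⟩, rfl⟩)

/-- Cholesky coordinates indexed by the edges: the entries of `D` at the loops, the entries of `L`
at the arrows. -/
def ofEdgeCoord : (G.Edge → ℝ) ≃ᵐ G.CholeskyCoord :=
  (MeasurableEquiv.piCongrLeft (fun _ => ℝ) G.edgeEquiv).symm.trans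
    (MeasurableEquiv.sumPiEquivProdPi fun _ => ℝ)

theorem ofEdgeCoord_apply (x : G.Edge → ℝ) :
    G.ofEdgeCoord x = (fun i => x (G.loop i), fun a => x (G.arrowEdge a)) := rfl

theorem measurePreserving_ofEdgeCoord : MeasurePreserving G.ofEdgeCoord :=
  ((volume_measurePreserving_piCongrLeft (fun _ => ℝ) G.edgeEquiv).symm).trans
    (volume_measurePreserving_sumPiEquivProdPi fun _ => ℝ)

theorem measurableSet_choleskySpace : MeasurableSet G.choleskySpace := by
  have : G.choleskySpace = ⋂ i, {θ | 0 < θ.1 i} := by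
    ext θ; simp [choleskySpace]
  rw [this]
  exact MeasurableSet.iInter fun i => measurableSet_lt measurable_const (by fun_prop)

/-- The sum of the products which make up `L D⁻¹ Lᵀ`, at the edges. -/
def psiSum (θ : G.CholeskyCoord) : G.Incomplete := fun e =>
  ∑ k, G.lowerMat θ.2 e.1.1 k * (θ.1 k)⁻¹ * G.lowerMat θ.2 e.1.2 k

/-- The two can differ outside the Cholesky space, where the inverse of a singular diagonal matrix
is zero by convention. The explicit sum is the version to measure and differentiate. -/
theorem psi_eq_psiSum {θ : G.CholeskyCoord} (hθ : θ ∈ G.choleskySpace) :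
    G.psi θ = G.psiSum θ := by
  ext e
  exact G.precisionOf_apply hθ _ _

theorem measurable_lowerMat (i j : Fin p) : Measurable fun l : G.Arrow → ℝ => G.lowerMat l i j := by
  simp only [lowerMat, Matrix.of_apply]
  split_ifs <;> fun_prop

theorem measurable_psiSum : Measurable G.psiSum := by
  refine measurable_pi_lambda _ fun e => Finset.measurable_sum _ fun k _ => ?_
  have h1 := (G.measurable_lowerMat e.1.1 k).comp (measurable_snd : Measurable (Prod.snd : G.CholeskyCoord → _))
  have h2 := (G.measurable_lowerMat e.1.2 k).comp (measurable_snd : Measurable (Prod.snd : G.CholeskyCoord → _))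
  exact (h1.mul ((measurable_pi_apply k).comp measurable_fst).inv).mul h2

/-- An injective measurable map between standard Borel spaces maps Borel sets to Borel sets. -/
theorem measurableSet_image_psi {s : Set G.CholeskyCoord} (hs : MeasurableSet s)
    (hsub : s ⊆ G.choleskySpace) : MeasurableSet (G.psi '' s) := by
  have h : G.psi '' s = G.psiSum '' s :=
    Set.image_congr fun θ hθ => G.psi_eq_psiSum (hsub hθ)
  rw [h]
  refine hs.image_of_measurable_injOn G.measurable_psiSum fun θ hθ θ' hθ' he => ?_
  rw [← G.psi_eq_psiSum (hsub hθ), ← G.psi_eq_psiSum (hsub hθ')] at he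
  exact G.psi_injOn (hsub hθ) (hsub hθ') he

/-- The derivative of an entry of `L` in the coordinates indexed by the edges. -/
def lowerDeriv (i j : Fin p) : (G.Edge → ℝ) →L[ℝ] ℝ :=
  if h : i ∈ G.pa j then ContinuousLinearMap.proj (G.arrowEdge ⟨(i, j), h⟩) else 0

theorem hasFDerivAt_lowerMat (x : G.Edge → ℝ) (i j : Fin p) :
    HasFDerivAt (fun x => G.lowerMat (G.ofEdgeCoord x).2 i j) (G.lowerDeriv i j) x := by
  have hi : ∀ i, i ∉ G.pa i := fun i h => lt_irrefl _ (G.lt_of_mem_pa _ _ h)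
  simp only [ofEdgeCoord_apply, lowerMat, Matrix.of_apply, lowerDeriv]
  by_cases hij : i = j
  · subst hij
    simpa [hi i] using hasFDerivAt_const (1 : ℝ) x
  · by_cases h : i ∈ G.pa j
    · simp only [hij, h, if_false, dif_pos]
      exact (ContinuousLinearMap.proj (R := ℝ) (φ := fun _ : G.Edge => ℝ)
        (G.arrowEdge ⟨(i, j), h⟩)).hasFDerivAt (x := x)
    · simpa [hij, h] using hasFDerivAt_const (0 : ℝ) x

/-- The derivative of one summand of an entry of `L D⁻¹ Lᵀ`. -/
def termDeriv (x : G.Edge → ℝ) (i j k : Fin p) : (G.Edge → ℝ) →L[ℝ] ℝ :=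
  (G.lowerMat (G.ofEdgeCoord x).2 i k * (x (G.loop k))⁻¹) • G.lowerDeriv j k +
    G.lowerMat (G.ofEdgeCoord x).2 j k • (G.lowerMat (G.ofEdgeCoord x).2 i k •
      (-(x (G.loop k) ^ 2)⁻¹ • ContinuousLinearMap.proj (G.loop k)) +
        (x (G.loop k))⁻¹ • G.lowerDeriv i k)

/-- The derivative of `psiSum` in the coordinates indexed by the edges. -/
def psiDeriv (x : G.Edge → ℝ) : (G.Edge → ℝ) →L[ℝ] (G.Edge → ℝ) :=
  ContinuousLinearMap.pi fun e => ∑ k, G.termDeriv x e.1.1 e.1.2 k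

theorem hasFDerivAt_psiSum {x : G.Edge → ℝ} (hx : ∀ i, 0 < x (G.loop i)) :
    HasFDerivAt (fun x => G.psiSum (G.ofEdgeCoord x)) (G.psiDeriv x) x := by
  refine hasFDerivAt_pi.2 fun e => HasFDerivAt.fun_sum fun k _ => ?_
  have hp := (ContinuousLinearMap.proj (R := ℝ) (φ := fun _ : G.Edge => ℝ)
        (G.loop k)).hasFDerivAt (x := x)
  have hinv := (hasDerivAt_inv (hx k).ne').comp_hasFDerivAt x hp
  exact ((G.hasFDerivAt_lowerMat x _ k).mul hinv).mul (G.hasFDerivAt_lowerMat x _ k)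

theorem lowerDeriv_single (i j : Fin p) (e : G.Edge) (h : e.1 ≠ (i, j)) :
    G.lowerDeriv i j (Pi.single e 1) = 0 := by
  rw [lowerDeriv]
  split_ifs with hij
  · have : G.arrowEdge ⟨(i, j), hij⟩ ≠ e := fun h' => h (by rw [← h']; rfl)
    simp [this]
  · rfl

theorem loop_single (k : Fin p) (e : G.Edge) (h : e.1 ≠ (k, k)) :
    (Pi.single e (1 : ℝ) : G.Edge → ℝ) (G.loop k) = 0 := by
  have : G.loop k ≠ e := fun h' => h (by rw [← h']; rfl)
  simp [this]

theorem termDeriv_single_of_ne (x : G.Edge → ℝ) (i j k : Fin p) (e : G.Edge) (h : e.1.2 ≠ k) :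
    G.termDeriv x i j k (Pi.single e 1) = 0 := by
  have h' : ∀ m, e.1 ≠ (m, k) := fun m hm => h (by rw [hm])
  simp [termDeriv, G.lowerDeriv_single _ _ _ (h' _), G.loop_single _ _ (h' _)]

/-- Summands `k < j` do not involve a coordinate from column `j` or later, and summands `k > j`
contain the factor `L_jk = 0`. -/
theorem sum_termDeriv_single (x : G.Edge → ℝ) (i j : Fin p) (e : G.Edge) (h : j ≤ e.1.2) :
    ∑ k, G.termDeriv x i j k (Pi.single e 1) = G.termDeriv x i j j (Pi.single e 1) := by
  refine Finset.sum_eq_single j (fun k _ hkj => ?_) (by simp)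
  rcases lt_or_gt_of_ne hkj with hk | hk
  · exact G.termDeriv_single_of_ne x i j k e (hk.trans_le h).ne'
  · have h1 : G.lowerMat (G.ofEdgeCoord x).2 j k = 0 := G.lowerMat_eq_zero_of_lt _ hk
    have h2 : G.lowerDeriv j k = 0 := by
      rw [lowerDeriv, dif_neg fun h => lt_asymm hk (G.lt_of_mem_pa _ _ h)]
    simp [termDeriv, h1, h2]

/-- Edges ordered by columns, and by rows within a column. -/
def edgeKey (e : G.Edge) : Fin p ×ₗ Fin p := toLex (e.1.2, e.1.1)

theorem edgeKey_injective : Function.Injective G.edgeKey := by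
  intro e e' h
  have h' := congrArg ofLex h
  simp only [edgeKey, ofLex_toLex, Prod.mk.injEq] at h'
  exact Subtype.ext (Prod.ext h'.2 h'.1)

/-- Besides earlier columns, the entry at `(i, j)` involves only `L_ij` and `D_j`. The loop comes
first in its column because all rows of an edge in column `j` are at least `j`, so neither
coordinate is later than `(i, j)`. -/
theorem psiDeriv_single_of_lt (x : G.Edge → ℝ) {e e' : G.Edge} (h : G.edgeKey e < G.edgeKey e') :
    G.psiDeriv x (Pi.single e' 1) e = 0 := by
  have hle : e.1.2 ≤ e'.1.2 := by
    rcases Prod.Lex.toLex_lt_toLex.1 h with h | h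
    · exact h.le
    · exact h.1.le
  have hne : e'.1 ≠ (e.1.1, e.1.2) := fun h' => h.ne (by rw [Subtype.ext h'])
  have hnl : e'.1 ≠ (e.1.2, e.1.2) := by
    intro h'
    rcases Prod.Lex.toLex_lt_toLex.1 h with h | h
    · rw [h'] at h; exact lt_irrefl _ h
    · rw [h'] at h; exact absurd h.2 (not_lt.2 (G.le_of_mem_fa e.2))
  have h0 : G.lowerDeriv e.1.2 e.1.2 = 0 := by
    rw [lowerDeriv, dif_neg fun h => lt_irrefl _ (G.lt_of_mem_pa _ _ h)]
  simp only [psiDeriv, ContinuousLinearMap.coe_pi', sum_apply]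
  rw [G.sum_termDeriv_single x _ _ _ hle]
  simp [termDeriv, h0, G.lowerDeriv_single _ _ _ hne, G.loop_single _ _ hnl]

theorem psiDeriv_single_loop (x : G.Edge → ℝ) (i : Fin p) :
    G.psiDeriv x (Pi.single (G.loop i) 1) (G.loop i) = -(x (G.loop i) ^ 2)⁻¹ := by
  simp only [psiDeriv, ContinuousLinearMap.coe_pi', sum_apply]
  rw [G.sum_termDeriv_single x _ _ _ le_rfl]
  have h0 : G.lowerDeriv i i = 0 := by
    rw [lowerDeriv, dif_neg fun h => lt_irrefl _ (G.lt_of_mem_pa _ _ h)]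
  simp [termDeriv, loop, h0]

theorem psiDeriv_single_arrow (x : G.Edge → ℝ) (a : G.Arrow) :
    G.psiDeriv x (Pi.single (G.arrowEdge a) 1) (G.arrowEdge a) = (x (G.loop a.1.2))⁻¹ := by
  simp only [psiDeriv, ContinuousLinearMap.coe_pi', sum_apply]
  rw [G.sum_termDeriv_single x _ _ _ le_rfl]
  have h0 : G.lowerDeriv a.1.2 a.1.2 = 0 := by
    rw [lowerDeriv, dif_neg fun h => lt_irrefl _ (G.lt_of_mem_pa _ _ h)]
  have h1 : G.lowerDeriv a.1.1 a.1.2 = ContinuousLinearMap.proj (G.arrowEdge a) := by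
    rw [lowerDeriv, dif_pos a.2]
  have h2 : (G.arrowEdge a).1 ≠ (a.1.2, a.1.2) := fun h =>
    (G.lt_of_mem_pa _ _ a.2).ne' (congrArg Prod.fst h)
  have h3 := G.loop_single _ _ h2
  change G.termDeriv x a.1.1 a.1.2 a.1.2 (Pi.single (G.arrowEdge a) 1) = _
  simp [termDeriv, h0, h1, h3]

/-- Arrows, grouped by the vertex at which they end. -/
def arrowEquiv : G.Arrow ≃ Σ j, G.pa j where
  toFun a := ⟨a.1.2, ⟨a.1.1, a.2⟩⟩
  invFun s := ⟨(s.2.1, s.1), s.2.2⟩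
  left_inv _ := rfl
  right_inv _ := rfl

/-- The absolute value of the Jacobian determinant of `psi`. -/
def jacobian (θ : G.CholeskyCoord) : ℝ := ∏ j, (θ.1 j)⁻¹ ^ ((G.pa j).card + 2)

theorem abs_det_psiDeriv {x : G.Edge → ℝ} (hx : ∀ i, 0 < x (G.loop i)) :
    |(G.psiDeriv x).det| = G.jacobian (G.ofEdgeCoord x) := by
  -- In this order the Jacobian matrix is lower triangular, so only its diagonal counts: `D_j⁻²` for
  -- the loop at `j` and `D_j⁻¹` for each arrow into `j`.
  let : LinearOrder G.Edge := LinearOrder.lift' G.edgeKey G.edgeKey_injective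
  have hdet : (G.psiDeriv x).det = ∏ e, G.psiDeriv x (Pi.single e 1) e := by
    rw [ContinuousLinearMap.det, ← LinearMap.det_toMatrix', Matrix.det_of_isLowerTriangular]
    · refine Finset.prod_congr rfl fun e _ => ?_
      rw [LinearMap.toMatrix'_apply]; rfl
    · intro e e' h
      rw [LinearMap.toMatrix'_apply]
      exact G.psiDeriv_single_of_lt x h
  rw [hdet, ← G.edgeEquiv.prod_comp, Fintype.prod_sum_type, abs_mul, Finset.abs_prod,
    Finset.abs_prod, jacobian]
  have h1 : ∀ i, |G.psiDeriv x (Pi.single (G.edgeEquiv (Sum.inl i)) 1) (G.edgeEquiv (Sum.inl i))|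
      = (x (G.loop i))⁻¹ ^ 2 := fun i => by
    change |G.psiDeriv x (Pi.single (G.loop i) 1) (G.loop i)| = _
    rw [psiDeriv_single_loop, abs_neg, inv_pow, abs_of_nonneg (by positivity)]
  have h2 : ∀ a, |G.psiDeriv x (Pi.single (G.edgeEquiv (Sum.inr a)) 1) (G.edgeEquiv (Sum.inr a))|
      = (x (G.loop a.1.2))⁻¹ := fun a => by
    change |G.psiDeriv x (Pi.single (G.arrowEdge a) 1) (G.arrowEdge a)| = _
    rw [psiDeriv_single_arrow, abs_of_pos (inv_pos.2 (hx _))]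
  simp_rw [h1, h2]
  rw [← G.arrowEquiv.symm.prod_comp, Fintype.prod_sigma, ← Finset.prod_mul_distrib]
  refine Finset.prod_congr rfl fun j _ => ?_
  simp [arrowEquiv, ofEdgeCoord_apply, pow_add, mul_comm]

/-- Change of variables along `psi`. The Cholesky coordinates are first reindexed by the edges, so
that source and target are the same space and the determinant makes sense. -/
theorem setLIntegral_incompletePrecision (g : G.Incomplete → ENNReal) :
    ∫⁻ Υ in G.incompletePrecision, g Υ =
      ∫⁻ θ in G.choleskySpace, ENNReal.ofReal (G.jacobian θ) * g (G.psi θ) := by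
  set s : Set (G.Edge → ℝ) := G.ofEdgeCoord ⁻¹' G.choleskySpace with hs
  have hsm : MeasurableSet s := G.ofEdgeCoord.measurable G.measurableSet_choleskySpace
  have hpos : ∀ x ∈ s, ∀ i, 0 < x (G.loop i) := fun x hx i => hx i
  have himg : G.incompletePrecision = (fun x => G.psiSum (G.ofEdgeCoord x)) '' s := by
    rw [incompletePrecision_eq_image]
    have h1 : G.choleskySpace = G.ofEdgeCoord '' s := by
      rw [hs, Set.image_preimage_eq _ G.ofEdgeCoord.surjective]
    conv_lhs => rw [h1]
    rw [Set.image_image]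
    exact Set.image_congr fun x hx => G.psi_eq_psiSum hx
  have hinj : Set.InjOn (fun x => G.psiSum (G.ofEdgeCoord x)) s := by
    intro x hx y hy h
    simp only at h
    rw [← G.psi_eq_psiSum hx, ← G.psi_eq_psiSum hy] at h
    exact G.ofEdgeCoord.injective (G.psi_injOn hx hy h)
  rw [himg, lintegral_image_eq_lintegral_abs_det_fderiv_mul volume hsm
    (fun x hx => (G.hasFDerivAt_psiSum (hpos x hx)).hasFDerivWithinAt) hinj,
    ← G.measurePreserving_ofEdgeCoord.setLIntegral_comp_preimage_emb
      G.ofEdgeCoord.measurableEmbedding]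
  refine setLIntegral_congr_fun hsm fun x hx => ?_
  rw [G.abs_det_psiDeriv (hpos x hx), G.psi_eq_psiSum hx]

end
end OrderedDAG

/-! ### Integrals of products over separate coordinates -/

section ProductIntegrals

theorem lintegral_fin_pi_prod {n : ℕ} {E : Fin n → Type*} [∀ i, MeasureSpace (E i)]
    [∀ i, SigmaFinite (volume : Measure (E i))] (f : (i : Fin n) → E i → ENNReal)
    (hf : ∀ i, Measurable (f i)) :
    ∫⁻ x : (i : Fin n) → E i, ∏ i, f i (x i) = ∏ i, ∫⁻ x, f i x := by
  induction n with
  | zero => simp [volume_pi]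
  | succ n ih =>
    have h : ∀ x : E 0 × ((i : Fin n) → E (Fin.succAbove 0 i)),
        ∏ i, f i ((MeasurableEquiv.piFinSuccAbove E 0).symm x i)
          = f 0 x.1 * ∏ i, f (Fin.succAbove 0 i) (x.2 i) := fun x => by
      rw [Fin.prod_univ_succAbove _ 0, show (MeasurableEquiv.piFinSuccAbove E 0).symm x
        = Fin.insertNth 0 x.1 x.2 from rfl, Fin.insertNth_apply_same]
      simp only [Fin.insertNth_apply_succAbove]
    rw [← (volume_preserving_piFinSuccAbove E 0).symm.lintegral_comp (by fun_prop)]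
    simp_rw [h]
    rw [Fin.prod_univ_succAbove _ 0, ← ih (fun i => f (Fin.succAbove 0 i)) fun i => hf _]
    exact lintegral_prod_mul (hf 0).aemeasurable (g := fun x : (i : Fin n) → E (Fin.succAbove 0 i) =>
      ∏ i : Fin n, f (Fin.succAbove 0 i) (x i))
      (Finset.measurable_prod _ fun i _ => (hf _).comp (measurable_pi_apply i)).aemeasurable

/-- Fubini's theorem for the lower Lebesgue integral of a product of functions of the coordinates. -/
theorem lintegral_pi_prod {ι : Type*} [Fintype ι] {E : ι → Type*} [∀ i, MeasureSpace (E i)]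
    [∀ i, SigmaFinite (volume : Measure (E i))] (f : (i : ι) → E i → ENNReal)
    (hf : ∀ i, Measurable (f i)) :
    ∫⁻ x : (i : ι) → E i, ∏ i, f i (x i) = ∏ i, ∫⁻ x, f i x := by
  let e := (Fintype.equivFin ι).symm
  rw [← (volume_measurePreserving_piCongrLeft _ e).lintegral_comp (by fun_prop)]
  simp_rw [← e.prod_comp, MeasurableEquiv.coe_piCongrLeft, Equiv.piCongrLeft_apply_apply]
  exact lintegral_fin_pi_prod _ fun i => hf _

theorem measurePreserving_sigmaUncurry {ι : Type*} [Fintype ι] {κ : ι → Type*}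
    [∀ i, Fintype (κ i)] :
    MeasurePreserving (MeasurableEquiv.piCurry fun (i : ι) (_ : κ i) => ℝ).symm := by
  refine ⟨MeasurableEquiv.measurable _, ?_⟩
  symm
  refine Measure.pi_eq fun s hs => ?_
  rw [Measure.map_apply (MeasurableEquiv.measurable _) (MeasurableSet.univ_pi hs)]
  have : (MeasurableEquiv.piCurry fun (i : ι) (_ : κ i) => ℝ).symm ⁻¹' (Set.univ.pi s)
      = Set.univ.pi fun i => Set.univ.pi fun k => s ⟨i, k⟩ := by
    ext x
    simp only [MeasurableEquiv.coe_piCurry_symm, Set.mem_preimage, Set.mem_univ_pi, Sigma.uncurry]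
    exact ⟨fun h i k => h ⟨i, k⟩, fun h a => h a.1 a.2⟩
  rw [this, volume_pi_pi, Fintype.prod_sigma]
  simp_rw [volume_pi_pi]

theorem lintegral_sigma_prod {ι : Type*} [Fintype ι] {κ : ι → Type*} [∀ i, Fintype (κ i)]
    (f : (i : ι) → (κ i → ℝ) → ENNReal) (hf : ∀ i, Measurable (f i)) :
    ∫⁻ x : (Σ i, κ i) → ℝ, ∏ i, f i (fun k => x ⟨i, k⟩) = ∏ i, ∫⁻ y, f i y := by
  rw [← lintegral_pi_prod f hf, ← measurePreserving_sigmaUncurry.lintegral_comp (by fun_prop)]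
  rfl

end ProductIntegrals

/-! ### Gaussian and inverse gamma integrals -/

section GaussianIntegrals

variable {ι : Type*} [Fintype ι]

theorem lintegral_exp_neg_mul_sq {b : ℝ} (hb : 0 < b) :
    ∫⁻ x : ℝ, ENNReal.ofReal (Real.exp (-b * x ^ 2)) = ENNReal.ofReal (√(Real.pi / b)) := by
  rw [← integral_gaussian b, ofReal_integral_eq_lintegral_ofReal (integrable_exp_neg_mul_sq hb)
    (Filter.Eventually.of_forall fun x => (Real.exp_pos _).le)]

theorem lintegral_exp_neg_mul_sum_sq {b : ℝ} (hb : 0 < b) :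
    ∫⁻ x : ι → ℝ, ENNReal.ofReal (Real.exp (-b * ∑ i, x i ^ 2))
      = ENNReal.ofReal (√(Real.pi / b) ^ Fintype.card ι) := by
  have h : ∀ x : ι → ℝ, ENNReal.ofReal (Real.exp (-b * ∑ i, x i ^ 2))
      = ∏ i, ENNReal.ofReal (Real.exp (-b * x i ^ 2)) := fun x => by
    rw [← ENNReal.ofReal_prod_of_nonneg fun i _ => (Real.exp_pos _).le, ← Real.exp_sum,
      Finset.mul_sum]
  simp_rw [h]
  rw [lintegral_pi_prod (fun _ x => ENNReal.ofReal (Real.exp (-b * x ^ 2))) (by fun_prop)]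
  simp only [lintegral_exp_neg_mul_sq hb, Finset.prod_const, Finset.card_univ]
  rw [ENNReal.ofReal_pow (Real.sqrt_nonneg _)]

variable [DecidableEq ι]

open scoped MatrixOrder in
-- Write `A = Bᵀ B` and substitute `y = B x`; the Jacobian is `|det B| = √(det A)`.
theorem lintegral_exp_neg_mul_quadratic {A : Matrix ι ι ℝ} (hA : A.PosDef) {b : ℝ} (hb : 0 < b) :
    ∫⁻ x : ι → ℝ, ENNReal.ofReal (Real.exp (-b * (x ⬝ᵥ A *ᵥ x)))
      = ENNReal.ofReal (√(Real.pi / b) ^ Fintype.card ι / √A.det) := by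
  obtain ⟨B, hB⟩ := CStarAlgebra.nonneg_iff_eq_star_mul_self.mp hA.posSemidef.nonneg
  rw [Matrix.star_eq_conjTranspose, Matrix.conjTranspose_eq_transpose_of_trivial] at hB
  have hdet : A.det = B.det ^ 2 := by rw [hB, Matrix.det_mul, Matrix.det_transpose, sq]
  have hB0 : B.det ≠ 0 := by
    intro h; have := hA.det_pos; rw [hdet, h] at this; simp at this
  have hq : ∀ x : ι → ℝ, x ⬝ᵥ A *ᵥ x = ∑ i, Matrix.toLin' B x i ^ 2 := fun x => by
    rw [hB, ← Matrix.mulVec_mulVec, Matrix.dotProduct_mulVec, Matrix.vecMul_transpose]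
    simp [dotProduct, sq]
  simp_rw [hq]
  have hm : Measurable (Matrix.toLin' B) :=
    (LinearMap.continuous_of_finiteDimensional _).measurable
  rw [← lintegral_map (μ := volume) (f := fun y : ι → ℝ =>
    ENNReal.ofReal (Real.exp (-b * ∑ i, y i ^ 2))) (by fun_prop) hm,
    Real.map_matrix_volume_pi_eq_smul_volume_pi hB0, lintegral_smul_measure,
    lintegral_exp_neg_mul_sum_sq hb, smul_eq_mul, ← ENNReal.ofReal_mul (abs_nonneg _), hdet,
    Real.sqrt_sq_eq_abs, abs_inv, mul_comm, ← div_eq_mul_inv]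

/-- Completing the square around `-A⁻¹ v`, followed by translation invariance. -/
theorem lintegral_exp_neg_mul_quadratic_add {A : Matrix ι ι ℝ} (hA : A.PosDef) {b : ℝ} (hb : 0 < b)
    (v : ι → ℝ) (c : ℝ) :
    ∫⁻ x : ι → ℝ, ENNReal.ofReal (Real.exp (-b * (c + 2 * (x ⬝ᵥ v) + x ⬝ᵥ A *ᵥ x)))
      = ENNReal.ofReal (Real.exp (-b * (c - v ⬝ᵥ A⁻¹ *ᵥ v)) *
        (√(Real.pi / b) ^ Fintype.card ι / √A.det)) := by
  have hu : IsUnit A.det := (Matrix.isUnit_iff_isUnit_det _).1 hA.isUnit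
  have hAt : Aᵀ = A := by
    have := hA.isHermitian.eq
    rwa [Matrix.conjTranspose_eq_transpose_of_trivial] at this
  set m := A⁻¹ *ᵥ v with hm
  have hAm : A *ᵥ m = v := by
    rw [hm, Matrix.mulVec_mulVec, Matrix.mul_nonsing_inv _ hu, Matrix.one_mulVec]
  have hq : ∀ x : ι → ℝ, c + 2 * (x ⬝ᵥ v) + x ⬝ᵥ A *ᵥ x
      = (c - v ⬝ᵥ m) + (x + m) ⬝ᵥ A *ᵥ (x + m) := fun x => by
    have h1 : m ⬝ᵥ A *ᵥ x = x ⬝ᵥ v := by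
      rw [Matrix.dotProduct_mulVec, ← Matrix.mulVec_transpose, hAt, hAm, dotProduct_comm]
    rw [Matrix.mulVec_add, dotProduct_add, add_dotProduct, add_dotProduct, hAm, h1,
      dotProduct_comm m v]
    ring
  simp_rw [hq, mul_add (-b), Real.exp_add, ENNReal.ofReal_mul (Real.exp_pos _).le]
  rw [lintegral_const_mul' _ _ ENNReal.ofReal_ne_top]
  congr 1
  rw [← lintegral_exp_neg_mul_quadratic hA hb]
  exact lintegral_add_right_eq_self
    (fun x : ι → ℝ => ENNReal.ofReal (Real.exp (-b * (x ⬝ᵥ A *ᵥ x)))) m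

end GaussianIntegrals

/-- The substitution `t = x⁻¹` turns this into the Gamma integral. -/
theorem lintegral_rpow_mul_exp_neg_mul_inv {a r : ℝ} (ha : 0 < a) (hr : 0 < r) :
    ∫⁻ x in Set.Ioi (0 : ℝ), ENNReal.ofReal (x ^ (-a - 1) * Real.exp (-(r * x⁻¹)))
      = ENNReal.ofReal ((1 / r) ^ a * Real.Gamma a) := by
  have h : ∫ x in Set.Ioi (0 : ℝ), x ^ (-a - 1) * Real.exp (-(r * x⁻¹))
      = (1 / r) ^ a * Real.Gamma a := by
    rw [← Real.integral_rpow_mul_exp_neg_mul_Ioi ha hr,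
      ← integral_comp_rpow_Ioi (fun t => t ^ (a - 1) * Real.exp (-(r * t)))
        (p := -1) (by norm_num)]
    refine setIntegral_congr_fun measurableSet_Ioi fun x hx => ?_
    have hx : 0 < x := hx
    simp only [smul_eq_mul, abs_neg, abs_one, one_mul]
    rw [← Real.rpow_mul hx.le, ← mul_assoc, ← Real.rpow_add hx, Real.rpow_neg_one]
    congr 2; ring
  have hpos : 0 < (1 / r) ^ a * Real.Gamma a := by
    have := Real.Gamma_pos_of_pos ha; positivity
  rw [← h, ofReal_integral_eq_lintegral_ofReal]
  -- A non-integrable function has integral zero by convention, so a nonzero value proves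
  -- integrability.
  · exact Integrable.of_integral_ne_zero (by rw [h]; exact hpos.ne')
  · filter_upwards [ae_restrict_mem measurableSet_Ioi] with x hx
    have hx : 0 < x := hx
    positivity

/-! ### The normalizing constant -/

namespace OrderedDAG
noncomputable section
variable {p : ℕ} (G : OrderedDAG p)

theorem notMem_pa_self (i : Fin p) : i ∉ G.pa i := fun h => lt_irrefl _ (G.lt_of_mem_pa _ _ h)

/-- A family consists of the parents and the vertex. -/
def familyEquiv (j : Fin p) : G.pa j ⊕ Unit ≃ G.fa j :=
  Equiv.ofBijective (Sum.elim (fun m => ⟨m.1, G.mem_fa_of_mem_pa m.2⟩)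
      fun _ => ⟨j, G.mem_fa_self j⟩) (by
    constructor
    · rintro (m | _) (n | _) h
      · simp only [Sum.elim_inl, Subtype.mk.injEq] at h
        rw [Subtype.ext h]
      · simp only [Sum.elim_inl, Sum.elim_inr, Subtype.mk.injEq] at h
        exact absurd (by have := m.2; rwa [h] at this) (G.notMem_pa_self j)
      · simp only [Sum.elim_inl, Sum.elim_inr, Subtype.mk.injEq] at h
        exact absurd (by have := n.2; rwa [← h] at this) (G.notMem_pa_self j)
      · rfl
    · rintro ⟨i, h⟩
      rcases Finset.mem_insert.1 h with rfl | h'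
      · exact ⟨Sum.inr (), rfl⟩
      · exact ⟨Sum.inl ⟨i, h'⟩, rfl⟩)

theorem principal_pa_posDef {V : Matrix (Fin p) (Fin p) ℝ} {j : Fin p}
    (h : (principal V (G.fa j)).PosDef) : (principal V (G.pa j)).PosDef :=
  h.submatrix (e := fun m : G.pa j => (⟨m.1, G.mem_fa_of_mem_pa m.2⟩ : G.fa j))
    fun _ _ hmn => Subtype.ext (congrArg (fun x : G.fa j => x.1) hmn)

theorem det_principal_fa {V : Matrix (Fin p) (Fin p) ℝ} {j : Fin p}
    (h : IsUnit (principal V (G.pa j)).det) :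
    (principal V (G.fa j)).det = (principal V (G.pa j)).det * G.schurAt V j := by
  let := Matrix.invertibleOfIsUnitDet _ h
  rw [← Matrix.det_submatrix_equiv_self (G.familyEquiv j)]
  have : (principal V (G.fa j)).submatrix (G.familyEquiv j) (G.familyEquiv j)
      = Matrix.fromBlocks (principal V (G.pa j)) (Matrix.of fun k (_ : Unit) => V k.1 j)
        (Matrix.of fun (_ : Unit) k => V j k.1) (Matrix.of fun _ _ => V j j) := by
    ext (m | _) (n | _) <;> rfl
  rw [this, Matrix.det_fromBlocks₁₁, Matrix.det_unique (n := Unit), schurAt, Matrix.invOf_eq_nonsing_inv,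
    Matrix.dotProduct_mulVec]
  congr 1

theorem schurAt_pos {V : Matrix (Fin p) (Fin p) ℝ} {j : Fin p}
    (h : (principal V (G.fa j)).PosDef) : 0 < G.schurAt V j := by
  have hp := (G.principal_pa_posDef h).det_pos
  have hf := h.det_pos
  rw [G.det_principal_fa hp.ne'.isUnit] at hf
  exact (pos_iff_pos_of_mul_pos hf).1 hp

/-- The entry `(Lᵀ V L)_{jj}` as a function of the `j`-th column of `L`. -/
def columnForm (V : Matrix (Fin p) (Fin p) ℝ) (j : Fin p) (y : G.pa j → ℝ) : ℝ :=
  V j j + 2 * (y ⬝ᵥ fun k => V k.1 j) + y ⬝ᵥ principal V (G.pa j) *ᵥ y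

theorem sum_lowerMat_mul_mul {V : Matrix (Fin p) (Fin p) ℝ} (hV : V.IsSymm) (l : G.Arrow → ℝ)
    (j : Fin p) :
    ∑ a, G.lowerMat l a j * ∑ b, G.lowerMat l b j * V b a
      = G.columnForm V j fun k => l ⟨(k.1, j), k.2⟩ := by
  rw [G.sum_lowerMat_mul]
  simp_rw [fun a => G.sum_lowerMat_mul l j fun b => V b a]
  simp only [columnForm, dotProduct, Matrix.mulVec, principal, Matrix.submatrix_apply, mul_add,
    Finset.sum_add_distrib]
  have h1 : ∀ k : Fin p, V j k = V k j := fun k => hV.apply k j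
  have h2 : ∀ k k' : Fin p, V k k' = V k' k := fun k k' => hV.apply k' k
  simp_rw [h1]
  rw [two_mul]
  have h3 : ∀ (m : G.pa j), ∑ n : G.pa j, l ⟨(n.1, j), n.2⟩ * V n.1 m.1
      = ∑ n : G.pa j, V m.1 n.1 * l ⟨(n.1, j), n.2⟩ := fun m =>
    Finset.sum_congr rfl fun n _ => by rw [h2 n.1 m.1, mul_comm]
  simp_rw [h3]
  ring

/-- By cyclicity the trace is that of `D⁻¹ Lᵀ V L`. Each diagonal entry sees one column of `L` only,
which is what decouples the vertices. -/
theorem trace_precisionOf_mul {V : Matrix (Fin p) (Fin p) ℝ} (hV : V.IsSymm)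
    {θ : G.CholeskyCoord} (hθ : θ ∈ G.choleskySpace) :
    (G.precisionOf θ * V).trace
      = ∑ j, (θ.1 j)⁻¹ * G.columnForm V j fun k => θ.2 ⟨(k.1, j), k.2⟩ := by
  simp_rw [← G.sum_lowerMat_mul_mul hV, Matrix.trace, Matrix.diag, Matrix.mul_apply,
    G.precisionOf_apply hθ, Finset.sum_mul, Finset.mul_sum]
  rw [Finset.sum_comm_cycle]
  refine Finset.sum_congr rfl fun k _ => Finset.sum_congr rfl fun a _ =>
    Finset.sum_congr rfl fun b _ => ?_
  ring

/-- The unnormalized density of the DAG-Wishart distribution on `Θ_G`. -/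
def wishartKernel (V : Matrix (Fin p) (Fin p) ℝ) (α : Fin p → ℝ) (θ : G.CholeskyCoord) : ℝ :=
  Real.exp (-(1 / 2) * (G.precisionOf θ * V).trace) * ∏ i, θ.1 i ^ (-(1 / 2) * α i)

/-- The contribution of one column of `L` and the corresponding entry of `D` to the unnormalized
density. -/
def columnKernel (V : Matrix (Fin p) (Fin p) ℝ) (α : Fin p → ℝ) (j : Fin p) (d : ℝ)
    (y : G.pa j → ℝ) : ENNReal :=
  (Set.Ioi (0 : ℝ)).indicator (fun d => ENNReal.ofReal (d ^ (-(1 / 2) * α j)) *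
    ENNReal.ofReal (Real.exp (-(1 / 2 * d⁻¹) * G.columnForm V j y))) d

theorem measurable_columnKernel (V : Matrix (Fin p) (Fin p) ℝ) (α : Fin p → ℝ) (j : Fin p) :
    Measurable fun q : ℝ × (G.pa j → ℝ) => G.columnKernel V α j q.1 q.2 := by
  have h : Measurable fun q : ℝ × (G.pa j → ℝ) => ENNReal.ofReal (q.1 ^ (-(1 / 2) * α j)) *
      ENNReal.ofReal (Real.exp (-(1 / 2 * q.1⁻¹) * G.columnForm V j q.2)) := by
    unfold columnForm
    simp only [dotProduct, Matrix.mulVec]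
    fun_prop
  exact h.indicator (measurable_fst measurableSet_Ioi)

theorem measurable_columnKernel_coord (V : Matrix (Fin p) (Fin p) ℝ) (α : Fin p → ℝ) (j : Fin p) :
    Measurable fun θ : G.CholeskyCoord =>
      G.columnKernel V α j (θ.1 j) fun k => θ.2 ⟨(k.1, j), k.2⟩ := by
  have hq : Measurable fun θ : G.CholeskyCoord =>
      ((θ.1 j, fun k : G.pa j => θ.2 ⟨(k.1, j), k.2⟩) : ℝ × (G.pa j → ℝ)) :=
    ((measurable_pi_apply j).comp measurable_fst).prodMk
      (measurable_pi_lambda _ fun k => (measurable_pi_apply _).comp measurable_snd)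
  have h := (G.measurable_columnKernel V α j).comp hq
  simpa only [Function.comp_def] using h

theorem measurable_columnKernel_right (V : Matrix (Fin p) (Fin p) ℝ) (α : Fin p → ℝ) (j : Fin p)
    (d : ℝ) : Measurable (G.columnKernel V α j d) := by
  have h := (G.measurable_columnKernel V α j).comp (measurable_prodMk_left (x := d))
  simpa only [Function.comp_def] using h

theorem indicator_wishartKernel {V : Matrix (Fin p) (Fin p) ℝ} (hV : V.IsSymm) (α : Fin p → ℝ)
    (θ : G.CholeskyCoord) :
    G.choleskySpace.indicator (fun θ => ENNReal.ofReal (G.wishartKernel V α θ)) θ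
      = ∏ j, G.columnKernel V α j (θ.1 j) fun k => θ.2 ⟨(k.1, j), k.2⟩ := by
  by_cases hθ : θ ∈ G.choleskySpace
  · have h : ∀ j, θ.1 j ∈ Set.Ioi (0 : ℝ) := hθ
    simp only [columnKernel, Set.indicator_of_mem hθ, Set.indicator_of_mem (h _)]
    rw [wishartKernel, G.trace_precisionOf_mul hV hθ, Finset.mul_sum, Real.exp_sum,
      ← Finset.prod_mul_distrib, ENNReal.ofReal_prod_of_nonneg]
    · refine Finset.prod_congr rfl fun j _ => ?_
      rw [mul_comm, ENNReal.ofReal_mul (Real.rpow_nonneg (hθ j).le _)]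
      congr 3; ring
    · intro j _
      exact mul_nonneg (Real.exp_pos _).le (Real.rpow_nonneg (hθ j).le _)
  · obtain ⟨j, hj⟩ : ∃ j, ¬ 0 < θ.1 j := by simpa [choleskySpace] using hθ
    rw [Set.indicator_of_notMem hθ, Finset.prod_eq_zero (Finset.mem_univ j)]
    rw [columnKernel, Set.indicator_of_notMem (s := Set.Ioi (0 : ℝ)) hj]

/-- The factor of the normalizing constant which belongs to one vertex. -/
def normFactor (V : Matrix (Fin p) (Fin p) ℝ) (α : Fin p → ℝ) (i : Fin p) : ℝ :=
  Real.Gamma (α i / 2 - G.paCard i / 2 - 1) * (2 : ℝ) ^ (α i / 2 - 1) *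
    (Real.sqrt Real.pi) ^ (G.pa i).card *
    (principal V (G.pa i)).det ^ (α i / 2 - G.paCard i / 2 - 3 / 2) /
    (principal V (G.fa i)).det ^ (α i / 2 - G.paCard i / 2 - 1)

/-- Integrating out the column of `L` is a Gaussian integral: it yields `(2πd)^(pa_j/2) / √(det
V_pa)` and leaves the Schur complement `c` in the exponent. What remains in `d` is an inverse gamma
integral of shape `a = α_j/2 - pa_j/2 - 1` and rate `c/2`; the bound on `α_j` says exactly that `a >
0`. -/
theorem lintegral_columnKernel {V : Matrix (Fin p) (Fin p) ℝ} {α : Fin p → ℝ} {j : Fin p}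
    (hV : (principal V (G.fa j)).PosDef) (hα : G.paCard j + 2 < α j) :
    ∫⁻ d, ∫⁻ y, G.columnKernel V α j d y = ENNReal.ofReal (G.normFactor V α j) := by
  have hpa := G.principal_pa_posDef hV
  have hc := G.schurAt_pos hV
  have hdp := hpa.det_pos
  have hsymm : (fun k : G.pa j => V k.1 j) = fun k : G.pa j => V j k.1 := by
    ext k
    have := hV.isHermitian.apply ⟨k.1, G.mem_fa_of_mem_pa k.2⟩ ⟨j, G.mem_fa_self j⟩
    simpa [principal] using this.symm
  set a : ℝ := α j / 2 - G.paCard j / 2 - 1 with ha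
  have ha0 : 0 < a := by rw [ha]; linarith
  set c := G.schurAt V j with hcdef
  set n := (G.pa j).card with hn
  set δ := (principal V (G.pa j)).det with hδ
  have hnR : G.paCard j = n := rfl
  have h1 : ∀ d, ∫⁻ y, G.columnKernel V α j d y = (Set.Ioi (0 : ℝ)).indicator (fun d =>
      ENNReal.ofReal (√(2 * Real.pi) ^ n / √δ) *
        ENNReal.ofReal (d ^ (-a - 1) * Real.exp (-(c / 2 * d⁻¹)))) d := by
    intro d
    by_cases hd : d ∈ Set.Ioi (0 : ℝ)
    · have hd' : 0 < d := hd
      simp only [columnKernel, Set.indicator_of_mem hd]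
      rw [lintegral_const_mul' _ _ ENNReal.ofReal_ne_top]
      simp only [columnForm]
      rw [lintegral_exp_neg_mul_quadratic_add hpa (by positivity : 0 < 1 / 2 * d⁻¹),
        ← ENNReal.ofReal_mul (by positivity), ← ENNReal.ofReal_mul (by positivity)]
      congr 1
      have hs : V j j - (fun k : G.pa j => V k.1 j) ⬝ᵥ
          (principal V (G.pa j))⁻¹ *ᵥ (fun k : G.pa j => V k.1 j) = c := by
        rw [hcdef, schurAt, ← hsymm]
      rw [hs, Fintype.card_coe, ← hn, ← hδ]
      have h2 : √(Real.pi / (1 / 2 * d⁻¹)) ^ n = √(2 * Real.pi) ^ n * d ^ ((n : ℝ) / 2) := by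
        rw [show Real.pi / (1 / 2 * d⁻¹) = (2 * Real.pi) * d by field_simp,
          Real.sqrt_mul (by positivity), mul_pow, Real.sqrt_eq_rpow d, ← Real.rpow_natCast,
          ← Real.rpow_natCast, ← Real.rpow_mul hd'.le]
        congr 2; ring
      have h3 : d ^ (-a - 1) = d ^ (-(1 / 2) * α j) * d ^ ((n : ℝ) / 2) := by
        rw [← Real.rpow_add hd', ha, hnR]; congr 1; ring
      rw [h2, h3, show -(1 / 2 * d⁻¹) * c = -(c / 2 * d⁻¹) by ring]
      ring
    · simp only [columnKernel, Set.indicator_of_notMem hd, lintegral_zero]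
  simp_rw [h1]
  rw [lintegral_indicator measurableSet_Ioi, lintegral_const_mul' _ _ ENNReal.ofReal_ne_top,
    lintegral_rpow_mul_exp_neg_mul_inv ha0 (by positivity), ← ENNReal.ofReal_mul (by positivity)]
  congr 1
  rw [normFactor, G.det_principal_fa hdp.ne'.isUnit, ← hcdef, ← hδ, ← ha, ← hn]
  have e1 : √(2 * Real.pi) ^ n = (2 : ℝ) ^ ((n : ℝ) / 2) * √Real.pi ^ n := by
    rw [Real.sqrt_mul (by norm_num), mul_pow, Real.sqrt_eq_rpow 2, ← Real.rpow_natCast,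
      ← Real.rpow_mul (by norm_num)]
    congr 2; ring
  have e2 : (1 / (c / 2)) ^ a = (2 : ℝ) ^ a / c ^ a := by
    rw [show 1 / (c / 2) = 2 / c by field_simp, Real.div_rpow (by norm_num) hc.le]
  have e3 : (2 : ℝ) ^ (α j / 2 - 1) = 2 ^ ((n : ℝ) / 2) * 2 ^ a := by
    rw [← Real.rpow_add (by norm_num), ha, hnR]; congr 1; ring
  have e4 : α j / 2 - G.paCard j / 2 - 3 / 2 = a - 1 / 2 := by rw [ha]; ring
  -- `det V_fa = det V_pa * c` supplies the power of `c`. The factor `(det V_pa)^(-1/2)` of the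
  -- Gaussian integral is the gap between the exponents with `3/2` and `1`.
  rw [e1, e2, e3, e4, Real.rpow_sub hdp, ← Real.sqrt_eq_rpow, Real.mul_rpow hdp.le hc.le]
  have : δ ^ a ≠ 0 := (Real.rpow_pos_of_pos hdp _).ne'
  have : c ^ a ≠ 0 := (Real.rpow_pos_of_pos hc _).ne'
  have : √δ ≠ 0 := (Real.sqrt_pos.2 hdp).ne'
  field_simp

theorem normFactor_pos {V : Matrix (Fin p) (Fin p) ℝ} {α : Fin p → ℝ} {j : Fin p}
    (hV : (principal V (G.fa j)).PosDef) (hα : G.paCard j + 2 < α j) : 0 < G.normFactor V α j := by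
  have h1 := (G.principal_pa_posDef hV).det_pos
  have h2 := hV.det_pos
  have h3 : 0 < Real.Gamma (α j / 2 - G.paCard j / 2 - 1) :=
    Real.Gamma_pos_of_pos (by linarith)
  unfold normFactor
  positivity

theorem normConst_eq_prod (V : Matrix (Fin p) (Fin p) ℝ) (α : Fin p → ℝ) :
    G.normConst V α = ∏ i, G.normFactor V α i := rfl

theorem normConst_pos {V : Matrix (Fin p) (Fin p) ℝ} {α : Fin p → ℝ}
    (hV : ∀ i, (principal V (G.fa i)).PosDef) (hα : ∀ i, G.paCard i + 2 < α i) :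
    0 < G.normConst V α :=
  Finset.prod_pos fun i _ => G.normFactor_pos (hV i) (hα i)

theorem lintegral_arrow_prod (f : (j : Fin p) → (G.pa j → ℝ) → ENNReal)
    (hf : ∀ j, Measurable (f j)) :
    ∫⁻ l : G.Arrow → ℝ, ∏ j, f j (fun k => l ⟨(k.1, j), k.2⟩) = ∏ j, ∫⁻ y, f j y := by
  rw [← lintegral_sigma_prod f hf,
    ← (volume_measurePreserving_piCongrLeft (fun _ => ℝ) G.arrowEquiv.symm).lintegral_comp_emb
      (MeasurableEquiv.measurableEmbedding _)]
  rfl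

/-- Positive definiteness is asked of the family blocks only, not of `V`; this is the generality
needed for `V = 2K + U`. -/
theorem lintegral_wishartKernel {V : Matrix (Fin p) (Fin p) ℝ} {α : Fin p → ℝ} (hVs : V.IsSymm)
    (hV : ∀ i, (principal V (G.fa i)).PosDef) (hα : ∀ i, G.paCard i + 2 < α i) :
    ∫⁻ θ in G.choleskySpace, ENNReal.ofReal (G.wishartKernel V α θ)
      = ENNReal.ofReal (G.normConst V α) := by
  have hmeas : Measurable fun θ : G.CholeskyCoord =>
      ∏ j, G.columnKernel V α j (θ.1 j) fun k => θ.2 ⟨(k.1, j), k.2⟩ :=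
    Finset.measurable_prod _ fun j _ => G.measurable_columnKernel_coord V α j
  rw [← lintegral_indicator G.measurableSet_choleskySpace]
  simp_rw [G.indicator_wishartKernel hVs]
  rw [Measure.volume_eq_prod, lintegral_prod _ hmeas.aemeasurable]
  simp_rw [fun d : Fin p → ℝ => G.lintegral_arrow_prod _
    fun j => G.measurable_columnKernel_right V α j (d j)]
  rw [lintegral_pi_prod (fun j d => ∫⁻ y, G.columnKernel V α j d y)
      fun j => (G.measurable_columnKernel V α j).lintegral_prod_right',
    normConst_eq_prod, ENNReal.ofReal_prod_of_nonneg
      fun i _ => (G.normFactor_pos (hV i) (hα i)).le]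
  exact Finset.prod_congr rfl fun j _ => G.lintegral_columnKernel (hV j) (hα j)

end
end OrderedDAG

/-! ### The distribution on incomplete matrices and its density -/

namespace OrderedDAG
noncomputable section
variable {p : ℕ} (G : OrderedDAG p)

theorem aemeasurable_precisionOf (i j : Fin p) :
    AEMeasurable (fun θ => G.precisionOf θ i j) (volume.restrict G.choleskySpace) := by
  refine ⟨fun θ => ∑ k, G.lowerMat θ.2 i k * (θ.1 k)⁻¹ * G.lowerMat θ.2 j k, ?_, ?_⟩
  · refine Finset.measurable_sum _ fun k _ => ?_
    have h1 := (G.measurable_lowerMat i k).comp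
      (measurable_snd : Measurable (Prod.snd : G.CholeskyCoord → _))
    have h2 := (G.measurable_lowerMat j k).comp
      (measurable_snd : Measurable (Prod.snd : G.CholeskyCoord → _))
    exact (h1.mul ((measurable_pi_apply k).comp measurable_fst).inv).mul h2
  · filter_upwards [ae_restrict_mem G.measurableSet_choleskySpace] with θ hθ
    exact G.precisionOf_apply hθ i j

theorem aemeasurable_trace_mul_precisionOf (K : Matrix (Fin p) (Fin p) ℝ) :
    AEMeasurable (fun θ => (K * G.precisionOf θ).trace) (volume.restrict G.choleskySpace) := by
  simp only [Matrix.trace, Matrix.diag, Matrix.mul_apply]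
  exact Finset.aemeasurable_fun_sum _ fun i _ => Finset.aemeasurable_fun_sum _ fun j _ =>
    (G.aemeasurable_precisionOf j i).const_mul _

theorem aemeasurable_wishartDensity (U : Matrix (Fin p) (Fin p) ℝ) (α : Fin p → ℝ) :
    AEMeasurable (G.wishartDensity U α) (volume.restrict G.choleskySpace) := by
  have h : G.wishartDensity U α = fun θ => (G.normConst U α)⁻¹ *
      Real.exp (-(1 / 2) * (U * G.precisionOf θ).trace) * ∏ i, θ.1 i ^ (-(1 / 2) * α i) := by
    ext θ; rw [wishartDensity, Matrix.trace_mul_comm]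
  rw [h]
  have h1 := G.aemeasurable_trace_mul_precisionOf U
  have h2 : Measurable fun θ : G.CholeskyCoord => ∏ i, θ.1 i ^ (-(1 / 2) * α i) :=
    Finset.measurable_prod _ fun i _ =>
      ((measurable_pi_apply i).comp measurable_fst).pow_const _
  exact ((Real.measurable_exp.comp_aemeasurable (h1.const_mul _)).const_mul _).mul h2.aemeasurable

theorem wishart_absolutelyContinuous (U : Matrix (Fin p) (Fin p) ℝ) (α : Fin p → ℝ) :
    G.wishart U α ≪ volume.restrict G.choleskySpace :=
  withDensity_absolutelyContinuous _ _

theorem ae_mem_choleskySpace (U : Matrix (Fin p) (Fin p) ℝ) (α : Fin p → ℝ) :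
    ∀ᵐ θ ∂G.wishart U α, θ ∈ G.choleskySpace :=
  (G.wishart_absolutelyContinuous U α).ae_le (ae_restrict_mem G.measurableSet_choleskySpace)

theorem wishartR_eq_map_psiSum (U : Matrix (Fin p) (Fin p) ℝ) (α : Fin p → ℝ) :
    G.wishartR U α = (G.wishart U α).map G.psiSum :=
  Measure.map_congr <| by
    filter_upwards [G.ae_mem_choleskySpace U α] with θ hθ using G.psi_eq_psiSum hθ

/-- Integrals can be transported along a measurable embedding without any measurability of the
integrand. This matters because `completion` is defined by choice. -/
theorem measurableEmbedding_psi :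
    MeasurableEmbedding fun θ : G.choleskySpace => G.psi θ.1 where
  injective θ θ' h := Subtype.ext (G.psi_injOn θ.2 θ'.2 h)
  measurable := by
    have : (fun θ : G.choleskySpace => G.psi θ.1) = fun θ => G.psiSum θ.1 :=
      funext fun θ => G.psi_eq_psiSum θ.2
    rw [this]
    exact G.measurable_psiSum.comp measurable_subtype_coe
  measurableSet_image' s hs := by
    have : (fun θ : G.choleskySpace => G.psi θ.1) '' s = G.psi '' (Subtype.val '' s) := by
      rw [Set.image_image]
    rw [this]
    exact G.measurableSet_image_psi (G.measurableSet_choleskySpace.subtype_image hs) (by simp)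

/-- The DAG-Wishart distribution as a measure on the subtype of the Cholesky space. -/
def wishartSubtype (U : Matrix (Fin p) (Fin p) ℝ) (α : Fin p → ℝ) : Measure G.choleskySpace :=
  (G.wishart U α).comap Subtype.val

theorem map_wishartSubtype (U : Matrix (Fin p) (Fin p) ℝ) (α : Fin p → ℝ) :
    (G.wishartSubtype U α).map Subtype.val = G.wishart U α := by
  rw [wishartSubtype, map_comap_subtype_coe G.measurableSet_choleskySpace,
    Measure.restrict_eq_self_of_ae_mem (G.ae_mem_choleskySpace U α)]

theorem wishartR_eq_map_wishartSubtype (U : Matrix (Fin p) (Fin p) ℝ) (α : Fin p → ℝ) :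
    G.wishartR U α = (G.wishartSubtype U α).map fun θ => G.psi θ.1 := by
  have h : (fun θ : G.choleskySpace => G.psi θ.1) = G.psiSum ∘ Subtype.val :=
    funext fun θ => G.psi_eq_psiSum θ.2
  rw [wishartR_eq_map_psiSum, ← map_wishartSubtype, h,
    Measure.map_map G.measurable_psiSum measurable_subtype_coe]

theorem integral_wishartR {E : Type*} [NormedAddCommGroup E] [NormedSpace ℝ E]
    (U : Matrix (Fin p) (Fin p) ℝ) (α : Fin p → ℝ) {f : G.Incomplete → E} {g : G.CholeskyCoord → E}
    (h : ∀ θ ∈ G.choleskySpace, f (G.psi θ) = g θ) :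
    ∫ Υ, f Υ ∂G.wishartR U α = ∫ θ, g θ ∂G.wishart U α := by
  rw [wishartR_eq_map_wishartSubtype, G.measurableEmbedding_psi.integral_map,
    ← map_wishartSubtype,
    (MeasurableEmbedding.subtype_coe G.measurableSet_choleskySpace).integral_map]
  exact integral_congr_ae (Filter.Eventually.of_forall fun θ => h θ.1 θ.2)

theorem integrable_wishartR_iff {E : Type*} [NormedAddCommGroup E]
    (U : Matrix (Fin p) (Fin p) ℝ) (α : Fin p → ℝ) {f : G.Incomplete → E} {g : G.CholeskyCoord → E}
    (h : ∀ θ ∈ G.choleskySpace, f (G.psi θ) = g θ) :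
    Integrable f (G.wishartR U α) ↔ Integrable g (G.wishart U α) := by
  rw [wishartR_eq_map_wishartSubtype, G.measurableEmbedding_psi.integrable_map_iff,
    ← map_wishartSubtype,
    (MeasurableEmbedding.subtype_coe G.measurableSet_choleskySpace).integrable_map_iff]
  exact integrable_congr (Filter.Eventually.of_forall fun θ => h θ.1 θ.2)

theorem wishartR_eq_withDensity (U : Matrix (Fin p) (Fin p) ℝ) (α : Fin p → ℝ) :
    G.wishartR U α = (volume.restrict G.incompletePrecision).withDensity (fun Υ =>
      ENNReal.ofReal ((G.normConst U α)⁻¹ *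
        Real.exp (-(1 / 2) * (G.completion Υ * U).trace) *
        ∏ i, G.schurAt (G.completion Υ)⁻¹ i ^ (-(1 / 2) * α i + G.paCard i + 2))) := by
  rw [wishartR_eq_map_psiSum]
  ext A hA
  have hA' : MeasurableSet (G.psiSum ⁻¹' A) := G.measurable_psiSum hA
  rw [Measure.map_apply G.measurable_psiSum hA, wishart, withDensity_apply _ hA',
    withDensity_apply _ hA, ← lintegral_indicator hA', ← lintegral_indicator hA,
    setLIntegral_incompletePrecision]
  refine setLIntegral_congr_fun G.measurableSet_choleskySpace fun θ hθ => ?_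
  have hiff : θ ∈ G.psiSum ⁻¹' A ↔ G.psi θ ∈ A := by
    rw [Set.mem_preimage, G.psi_eq_psiSum hθ]
  by_cases h : G.psi θ ∈ A
  · rw [Set.indicator_of_mem (hiff.2 h), Set.indicator_of_mem h, G.completion_psi hθ,
      ← ENNReal.ofReal_mul (show 0 ≤ G.jacobian θ from
        Finset.prod_nonneg fun j _ => by have := hθ j; positivity)]
    congr 1
    rw [wishartDensity, jacobian]
    simp_rw [G.schurAt_inv_precisionOf hθ]
    rw [mul_left_comm, ← Finset.prod_mul_distrib]
    congr 1
    refine Finset.prod_congr rfl fun j _ => ?_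
    have hj := hθ j
    -- The Jacobian factor `D_j ^ (-(pa_j + 2))` cancels the extra exponent `pa_j + 2` of the
    -- density on `R_G`.
    rw [inv_pow, add_assoc, Real.rpow_add hj, mul_left_comm,
      show G.paCard j + 2 = (((G.pa j).card + 2 : ℕ) : ℝ) by simp [paCard], Real.rpow_natCast,
      inv_mul_cancel₀ (pow_pos hj _).ne', mul_one]
  · rw [Set.indicator_of_notMem (fun h' => h (hiff.1 h')), Set.indicator_of_notMem h, mul_zero]

theorem isSymm_of_posDef {U : Matrix (Fin p) (Fin p) ℝ} (hU : U.PosDef) : U.IsSymm := by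
  have := hU.isHermitian.eq
  rwa [Matrix.conjTranspose_eq_transpose_of_trivial] at this

theorem exp_mul_wishartDensity (U K : Matrix (Fin p) (Fin p) ℝ) (α : Fin p → ℝ)
    (θ : G.CholeskyCoord) :
    G.wishartDensity U α θ * Real.exp (-(K * G.precisionOf θ).trace)
      = (G.normConst U α)⁻¹ * G.wishartKernel ((2 : ℝ) • K + U) α θ := by
  have h : Real.exp (-(1 / 2) * (G.precisionOf θ * ((2 : ℝ) • K + U)).trace)
      = Real.exp (-(1 / 2) * (G.precisionOf θ * U).trace)
        * Real.exp (-(K * G.precisionOf θ).trace) := by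
    rw [← Real.exp_add, Matrix.mul_add, Matrix.trace_add, Matrix.mul_smul, Matrix.trace_smul,
      Matrix.trace_mul_comm K]
    congr 1
    simp only [smul_eq_mul]; ring
  rw [wishartDensity, wishartKernel, h]
  ring

/-! ### The Laplace transform -/

section Laplace

variable {U K : Matrix (Fin p) (Fin p) ℝ} {α : Fin p → ℝ}

theorem lintegral_exp_wishart (hU : U.PosDef) (hα : ∀ i, G.paCard i + 2 < α i) (hK : K.IsSymm)
    (hKU : ∀ i, (principal ((2 : ℝ) • K + U) (G.fa i)).PosDef) :
    ∫⁻ θ, ENNReal.ofReal (Real.exp (-(K * G.precisionOf θ).trace)) ∂G.wishart U α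
      = ENNReal.ofReal (G.normConst ((2 : ℝ) • K + U) α / G.normConst U α) := by
  have hz : 0 < G.normConst U α := G.normConst_pos (fun i => principal_posDef hU _) hα
  have hd : AEMeasurable (fun θ => ENNReal.ofReal (G.wishartDensity U α θ))
      (volume.restrict G.choleskySpace) :=
    ENNReal.measurable_ofReal.comp_aemeasurable (G.aemeasurable_wishartDensity U α)
  have he : AEMeasurable (fun θ => ENNReal.ofReal (Real.exp (-(K * G.precisionOf θ).trace)))
      (volume.restrict G.choleskySpace) :=
    ENNReal.measurable_ofReal.comp_aemeasurable (Real.measurable_exp.comp_aemeasurable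
      (G.aemeasurable_trace_mul_precisionOf K).neg)
  rw [wishart, lintegral_withDensity_eq_lintegral_mul₀ hd he]
  have h : ∀ θ ∈ G.choleskySpace, ((fun θ => ENNReal.ofReal (G.wishartDensity U α θ)) *
      fun θ => ENNReal.ofReal (Real.exp (-(K * G.precisionOf θ).trace))) θ
      = ENNReal.ofReal (G.normConst U α)⁻¹ *
        ENNReal.ofReal (G.wishartKernel ((2 : ℝ) • K + U) α θ) := fun θ hθ => by
    rw [Pi.mul_apply, ← ENNReal.ofReal_mul' (Real.exp_pos _).le, exp_mul_wishartDensity,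
      ENNReal.ofReal_mul (inv_nonneg.2 hz.le)]
  rw [setLIntegral_congr_fun G.measurableSet_choleskySpace h,
    lintegral_const_mul' _ _ ENNReal.ofReal_ne_top,
    G.lintegral_wishartKernel ((hK.smul _).add (isSymm_of_posDef hU)) hKU hα,
    ← ENNReal.ofReal_mul (inv_nonneg.2 hz.le), inv_mul_eq_div]

theorem integrable_exp_wishart (hU : U.PosDef) (hα : ∀ i, G.paCard i + 2 < α i) (hK : K.IsSymm)
    (hKU : ∀ i, (principal ((2 : ℝ) • K + U) (G.fa i)).PosDef) :
    Integrable (fun θ => Real.exp (-(K * G.precisionOf θ).trace)) (G.wishart U α) := by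
  have hm : AEMeasurable (fun θ => Real.exp (-(K * G.precisionOf θ).trace)) (G.wishart U α) :=
    Real.measurable_exp.comp_aemeasurable ((G.aemeasurable_trace_mul_precisionOf K).mono_ac
      (G.wishart_absolutelyContinuous U α)).neg
  refine ⟨hm.aestronglyMeasurable, ?_⟩
  rw [hasFiniteIntegral_iff_ofReal (Filter.Eventually.of_forall fun θ => (Real.exp_pos _).le),
    G.lintegral_exp_wishart hU hα hK hKU]
  exact ENNReal.ofReal_lt_top

theorem integral_exp_wishart (hU : U.PosDef) (hα : ∀ i, G.paCard i + 2 < α i) (hK : K.IsSymm)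
    (hKU : ∀ i, (principal ((2 : ℝ) • K + U) (G.fa i)).PosDef) :
    ∫ θ, Real.exp (-(K * G.precisionOf θ).trace) ∂G.wishart U α
      = G.normConst ((2 : ℝ) • K + U) α / G.normConst U α := by
  rw [integral_eq_lintegral_of_nonneg_ae (Filter.Eventually.of_forall fun θ => (Real.exp_pos _).le)
    (G.integrable_exp_wishart hU hα hK hKU).1, G.lintegral_exp_wishart hU hα hK hKU,
    ENNReal.toReal_ofReal]
  exact div_nonneg (G.normConst_pos hKU hα).le
    (G.normConst_pos (fun i => principal_posDef hU _) hα).le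

end Laplace

/-- Zero filling loses only the entries at non-adjacent `i`, `j`. There the completed entry is a sum
over `k` with `i` and `j` both in `fa k`, and non-adjacency forces such a `k` to be a common child.
So either there is none and the entry is zero, or `K i j = 0` by hypothesis. -/
theorem trace_zeroFill_mul_zeroFill {K : Matrix (Fin p) (Fin p) ℝ} (hK : K.IsSymm)
    (h0 : ∀ i j k, i ∈ G.pa k → j ∈ G.pa k → i ∉ G.fa j → j ∉ G.fa i → K i j = 0)
    {θ : G.CholeskyCoord} (hθ : θ ∈ G.choleskySpace) :
    (G.zeroFill (G.proj K) * G.zeroFill (G.psi θ)).trace = (K * G.precisionOf θ).trace := by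
  have hΩ := G.precisionOf_isSymm hθ
  simp only [Matrix.trace, Matrix.diag, Matrix.mul_apply]
  refine Finset.sum_congr rfl fun i _ => Finset.sum_congr rfl fun j _ => ?_
  by_cases hij : i ∈ G.fa j
  · by_cases hji : j ∈ G.fa i
    · have : i = j := le_antisymm (G.le_of_mem_fa hji) (G.le_of_mem_fa hij)
      subst this
      simp [zeroFill, proj, psi, hij]
    · simp [zeroFill, proj, psi, hij, hji, hΩ.apply i j]
  · by_cases hji : j ∈ G.fa i
    · simp [zeroFill, proj, psi, hij, hji, hK.apply i j]
    · simp only [zeroFill, Matrix.of_apply, hij, hji, dif_neg, not_false_eq_true, zero_mul]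
      symm
      rw [mul_eq_zero]
      by_cases hk : ∃ k, i ∈ G.pa k ∧ j ∈ G.pa k
      · obtain ⟨k, hik, hjk⟩ := hk
        exact Or.inl (h0 i j k hik hjk hij hji)
      · right
        rw [G.precisionOf_apply hθ]
        refine Finset.sum_eq_zero fun k _ => ?_
        by_cases hjk : j ∈ G.fa k
        · by_cases hik : i ∈ G.fa k
          · rcases Finset.mem_insert.1 hjk with rfl | hjk'
            · exact absurd hik hij
            · rcases Finset.mem_insert.1 hik with rfl | hik'
              · exact absurd hjk hji
              · exact absurd ⟨k, hik', hjk'⟩ hk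
          · rw [G.lowerMat_eq_zero_of_notMem_fa _ hik, mul_zero]
        · rw [G.lowerMat_eq_zero_of_notMem_fa _ hjk, zero_mul, zero_mul]

end
end OrderedDAG

/-! ### Perturbation of positive definite matrices and determinants -/

section Perturbation

open Filter Topology

variable {ι : Type*} [Fintype ι]

/-- The quadratic form is positive on the compact unit sphere, hence stays positive there for all
small `t`; homogeneity extends this to all nonzero vectors. -/
theorem Matrix.PosDef.eventually_add_smul {A B : Matrix ι ι ℝ} (hA : A.PosDef)
    (hB : B.IsHermitian) : ∀ᶠ t : ℝ in 𝓝 0, (A + t • B).PosDef := by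
  have hcont : Continuous fun q : ℝ × (ι → ℝ) => q.2 ⬝ᵥ (A + q.1 • B) *ᵥ q.2 := by
    simp only [dotProduct, Matrix.mulVec, Matrix.add_apply, Matrix.smul_apply, smul_eq_mul]
    fun_prop
  have h : ∀ᶠ t : ℝ in 𝓝 0, ∀ x ∈ Metric.sphere (0 : ι → ℝ) 1, 0 < x ⬝ᵥ (A + t • B) *ᵥ x := by
    refine (isCompact_sphere (0 : ι → ℝ) 1).eventually_forall_of_forall_eventually fun x hx => ?_
    have hx0 : x ≠ 0 := by rintro rfl; simp at hx
    have hpos : 0 < x ⬝ᵥ A *ᵥ x := by simpa using hA.dotProduct_mulVec_pos hx0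
    exact hcont.continuousAt.eventually (lt_mem_nhds (by simpa using hpos))
  filter_upwards [h] with t ht
  refine Matrix.PosDef.of_dotProduct_mulVec_pos (hA.isHermitian.add (hB.smul (by simp [IsSelfAdjoint])))
    fun x hx => ?_
  have hn : 0 < ‖x‖ := norm_pos_iff.2 hx
  have h1 := ht (‖x‖⁻¹ • x) (by simp [norm_smul, hn.ne'])
  rw [Matrix.mulVec_smul, dotProduct_smul, smul_dotProduct] at h1
  simp only [smul_eq_mul] at h1
  rw [star_trivial]
  exact pos_of_mul_pos_right (pos_of_mul_pos_right h1 (by positivity)) (by positivity)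

/-- `det(A + tB) = det A * det(1 + t A⁻¹ B)`, and the second factor is a polynomial in `t` with
constant term 1 and linear coefficient `tr(A⁻¹ B)`. -/
theorem Matrix.hasDerivAt_det_add_smul [DecidableEq ι] {A : Matrix ι ι ℝ} (hA : IsUnit A.det) (B : Matrix ι ι ℝ) :
    HasDerivAt (fun t : ℝ => (A + t • B).det) (A.det * (A⁻¹ * B).trace) 0 := by
  have h : ∀ t : ℝ, (A + t • B).det = A.det * (1 + (A⁻¹ * B).trace * t +
      (1 + (Polynomial.X : Polynomial ℝ) • (A⁻¹ * B).map Polynomial.C).det.divX.divX.eval t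
        * t ^ 2) := fun t => by
    rw [← Matrix.det_one_add_smul, ← Matrix.det_mul, Matrix.mul_add, Matrix.mul_one,
      Matrix.mul_smul, Matrix.mul_nonsing_inv_cancel_left _ _ hA]
  simp_rw [h]
  refine HasDerivAt.const_mul _ ?_
  have h2 := ((hasDerivAt_id (0 : ℝ)).const_mul (A⁻¹ * B).trace).const_add (1 : ℝ)
  have h3 := ((1 + (Polynomial.X : Polynomial ℝ) • (A⁻¹ * B).map Polynomial.C).det.divX.divX.hasDerivAt
    (0 : ℝ)).mul ((hasDerivAt_id (0 : ℝ)).pow 2)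
  exact (h2.add h3).congr_deriv (by simp)

theorem HasDerivAt.rpow_const_of_logDeriv {f : ℝ → ℝ} {τ : ℝ} (h : HasDerivAt f (f 0 * τ) 0)
    (h0 : 0 < f 0) (b : ℝ) : HasDerivAt (fun t => f t ^ b) (f 0 ^ b * (b * τ)) 0 := by
  convert h.rpow_const (p := b) (Or.inl h0.ne') using 1
  rw [Real.rpow_sub_one h0.ne']
  field_simp

end Perturbation

/-! ### The mean -/

namespace OrderedDAG
noncomputable section
open Filter Topology
variable {p : ℕ} (G : OrderedDAG p)

/-- The logarithmic derivative of a factor of the normalizing constant. -/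
theorem hasDerivAt_normFactor {U : Matrix (Fin p) (Fin p) ℝ} (hU : U.PosDef) (α : Fin p → ℝ)
    (M : Matrix (Fin p) (Fin p) ℝ) (i : Fin p) :
    HasDerivAt (fun t : ℝ => G.normFactor (U + t • M) α i)
      (G.normFactor U α i * ((α i / 2 - G.paCard i / 2 - 3 / 2) *
          ((principal U (G.pa i))⁻¹ * principal M (G.pa i)).trace -
        (α i / 2 - G.paCard i / 2 - 1) *
          ((principal U (G.fa i))⁻¹ * principal M (G.fa i)).trace)) 0 := by
  have hp := (principal_posDef hU (G.pa i)).det_pos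
  have hf := (principal_posDef hU (G.fa i)).det_pos
  set a := α i / 2 - G.paCard i / 2 - 1
  set b := α i / 2 - G.paCard i / 2 - 3 / 2
  have h1 := Matrix.hasDerivAt_det_add_smul hp.ne'.isUnit (principal M (G.pa i))
  have h2 := Matrix.hasDerivAt_det_add_smul hf.ne'.isUnit (principal M (G.fa i))
  have h1' := HasDerivAt.rpow_const_of_logDeriv (f := fun t : ℝ =>
    (principal U (G.pa i) + t • principal M (G.pa i)).det) (by simpa using h1) (by simpa using hp) b
  have h2' := HasDerivAt.rpow_const_of_logDeriv (f := fun t : ℝ =>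
    (principal U (G.fa i) + t • principal M (G.fa i)).det) (by simpa using h2) (by simpa using hf) a
  simp only [zero_smul, add_zero] at h1' h2'
  have hne : (principal U (G.fa i)).det ^ a ≠ 0 := (Real.rpow_pos_of_pos hf _).ne'
  have h3 := (h1'.const_mul (Real.Gamma a * (2 : ℝ) ^ (α i / 2 - 1) * √Real.pi ^ (G.pa i).card)).div
    h2' (by simpa using hne)
  refine HasDerivAt.congr_deriv (f := fun t : ℝ => G.normFactor (U + t • M) α i) h3 ?_
  rw [show G.normFactor U α i = Real.Gamma a * (2 : ℝ) ^ (α i / 2 - 1) *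
    √Real.pi ^ (G.pa i).card * (principal U (G.pa i)).det ^ b / (principal U (G.fa i)).det ^ a
    from rfl]
  simp only [zero_smul, add_zero]
  clear_value a b
  field_simp

/-- The mean of the completion under the DAG-Wishart distribution. -/
def meanMat (U : Matrix (Fin p) (Fin p) ℝ) (α : Fin p → ℝ) : Matrix (Fin p) (Fin p) ℝ :=
  ∑ j, (α j - G.paCard j - 2) • zeroPad (principal U (G.fa j))⁻¹ -
    ∑ j, (α j - G.paCard j - 3) • zeroPad (principal U (G.pa j))⁻¹

theorem trace_zeroPad_mul {s : Finset (Fin p)} (B : Matrix s s ℝ) (K : Matrix (Fin p) (Fin p) ℝ) :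
    (zeroPad B * K).trace = (B * principal K s).trace := by
  have hs : ∀ f : Fin p → ℝ, (∀ i ∉ s, f i = 0) → ∑ i, f i = ∑ i : s, f i.1 := fun f hf => by
    rw [Finset.sum_coe_sort s f]
    exact (Finset.sum_subset (Finset.subset_univ s) fun i _ hi => hf i hi).symm
  simp only [Matrix.trace, Matrix.diag, Matrix.mul_apply, principal, Matrix.submatrix_apply]
  rw [hs]
  · refine Finset.sum_congr rfl fun i _ => ?_
    rw [hs]
    · exact Finset.sum_congr rfl fun j _ => by simp [zeroPad]
    · intro j hj; simp [zeroPad, hj]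
  · intro i hi
    exact Finset.sum_eq_zero fun j _ => by simp [zeroPad, hi]

theorem zeroPad_isSymm {s : Finset (Fin p)} {B : Matrix s s ℝ} (hB : B.IsSymm) :
    (zeroPad B).IsSymm := by
  ext i j
  simp only [Matrix.transpose_apply, zeroPad, Matrix.of_apply]
  by_cases h : i ∈ s ∧ j ∈ s
  · rw [dif_pos h, dif_pos h.symm, hB.apply]
  · rw [dif_neg h, dif_neg fun h' => h h'.symm]

theorem meanMat_isSymm {U : Matrix (Fin p) (Fin p) ℝ} (hU : U.PosDef) (α : Fin p → ℝ) :
    (G.meanMat U α).IsSymm := by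
  have h : ∀ s : Finset (Fin p), (zeroPad (principal U s)⁻¹).IsSymm := fun s => by
    refine zeroPad_isSymm ?_
    have := (principal_posDef hU s).inv.isHermitian.eq
    rwa [Matrix.conjTranspose_eq_transpose_of_trivial] at this
  ext i j
  simp only [meanMat, Matrix.transpose_apply, Matrix.sub_apply, Matrix.sum_apply,
    Matrix.smul_apply, (h _).apply i j]

theorem trace_meanMat_mul (U : Matrix (Fin p) (Fin p) ℝ) (α : Fin p → ℝ)
    (K : Matrix (Fin p) (Fin p) ℝ) :
    (G.meanMat U α * K).trace
      = ∑ j, ((α j - G.paCard j - 2) * ((principal U (G.fa j))⁻¹ * principal K (G.fa j)).trace -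
        (α j - G.paCard j - 3) * ((principal U (G.pa j))⁻¹ * principal K (G.pa j)).trace) := by
  simp only [meanMat, Matrix.sub_mul, Matrix.sum_mul, Matrix.smul_mul, Matrix.trace_sub,
    Matrix.trace_sum, Matrix.trace_smul, trace_zeroPad_mul, smul_eq_mul, Finset.sum_sub_distrib]

/-- The direction `-2K` comes from `2(-t)K + U`. Its factor `-2` doubles the exponents of the
determinants to `α_j - pa_j - 2` and `α_j - pa_j - 3` and makes the family terms positive. -/
theorem hasDerivAt_normConst_ratio {U : Matrix (Fin p) (Fin p) ℝ} (hU : U.PosDef) {α : Fin p → ℝ}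
    (hα : ∀ i, G.paCard i + 2 < α i) (K : Matrix (Fin p) (Fin p) ℝ) :
    HasDerivAt (fun t : ℝ => G.normConst (U + t • ((-2 : ℝ) • K)) α / G.normConst U α)
      (G.meanMat U α * K).trace 0 := by
  have hz : ∀ i, G.normFactor U α i ≠ 0 := fun i =>
    (G.normFactor_pos (principal_posDef hU _) (hα i)).ne'
  simp only [normConst_eq_prod, ← Finset.prod_div_distrib]
  have h := HasDerivAt.fun_finsetProd (u := Finset.univ) fun i _ =>
    (G.hasDerivAt_normFactor hU α ((-2 : ℝ) • K) i).div_const (G.normFactor U α i)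
  refine h.congr_deriv ?_
  rw [trace_meanMat_mul]
  refine Finset.sum_congr rfl fun i _ => ?_
  -- In the product rule, every undifferentiated factor is a ratio equal to 1 at `t = 0`.
  rw [Finset.prod_eq_one fun j _ => by simp [hz j], one_smul, mul_div_cancel_left₀ _ (hz i)]
  have hps : ∀ s : Finset (Fin p), principal ((-2 : ℝ) • K) s = (-2 : ℝ) • principal K s :=
    fun s => rfl
  simp only [hps, Matrix.mul_smul, Matrix.trace_smul, smul_eq_mul]
  ring

/-- For small `t` the matrix `U - 2tK` is positive definite, so the Laplace formula at `-tK` makes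
`exp(t tr(KΩ))` integrable and evaluates the moment generating function. Finiteness near zero gives
the first moment as its derivative at zero. -/
theorem wishart_mean_trace {U K : Matrix (Fin p) (Fin p) ℝ} (hU : U.PosDef) {α : Fin p → ℝ}
    (hα : ∀ i, G.paCard i + 2 < α i) (hK : K.IsSymm) :
    Integrable (fun θ => (K * G.precisionOf θ).trace) (G.wishart U α) ∧
      ∫ θ, (K * G.precisionOf θ).trace ∂G.wishart U α = (G.meanMat U α * K).trace := by
  set X : G.CholeskyCoord → ℝ := fun θ => (K * G.precisionOf θ).trace with hX
  have hPD : ∀ᶠ t : ℝ in 𝓝 0, (U + t • ((-2 : ℝ) • K)).PosDef :=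
    hU.eventually_add_smul (by
      rw [Matrix.IsHermitian, Matrix.conjTranspose_eq_transpose_of_trivial]
      exact (hK.smul _).eq)
  have hKt : ∀ t : ℝ, (2 : ℝ) • ((-t) • K) + U = U + t • ((-2 : ℝ) • K) := fun t => by
    rw [smul_smul, smul_smul, add_comm]; congr 2; ring
  have hXt : ∀ t θ, Real.exp (t * X θ) = Real.exp (-(((-t) • K) * G.precisionOf θ).trace) :=
    fun t θ => by
      rw [Matrix.smul_mul, Matrix.trace_smul, smul_eq_mul, neg_mul, neg_neg]
  have hI : ∀ᶠ t : ℝ in 𝓝 0, t ∈ integrableExpSet X (G.wishart U α) ∧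
      mgf X (G.wishart U α) t = G.normConst (U + t • ((-2 : ℝ) • K)) α / G.normConst U α := by
    filter_upwards [hPD] with t ht
    have hKU : ∀ i, (principal ((2 : ℝ) • ((-t) • K) + U) (G.fa i)).PosDef := fun i => by
      rw [hKt]; exact principal_posDef ht _
    constructor
    · simpa only [integrableExpSet, Set.mem_ofPred_eq, hXt] using
        G.integrable_exp_wishart hU hα (hK.smul (-t)) hKU
    · simp only [mgf, hXt]
      rw [G.integral_exp_wishart hU hα (hK.smul (-t)) hKU, hKt]
  have h0 : 0 ∈ interior (integrableExpSet X (G.wishart U α)) :=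
    mem_interior_iff_mem_nhds.2 (hI.mono fun t ht => ht.1)
  refine ⟨integrable_of_mem_interior_integrableExpSet h0, ?_⟩
  rw [← deriv_mgf_zero h0]
  exact ((G.hasDerivAt_normConst_ratio hU hα K).congr_of_eventuallyEq
    (hI.mono fun t ht => ht.2)).deriv

/-- The symmetric matrix which is dual to the entry `(i, j)`. -/
def dualMat (i j : Fin p) : Matrix (Fin p) (Fin p) ℝ :=
  (1 / 2 : ℝ) • (Matrix.single i j 1 + Matrix.single j i 1)

theorem dualMat_isSymm (i j : Fin p) : (dualMat i j).IsSymm := by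
  rw [Matrix.IsSymm, dualMat, Matrix.transpose_smul, Matrix.transpose_add,
    Matrix.transpose_single, Matrix.transpose_single, add_comm]

/-- Entries are extracted by a symmetrized matrix unit because the formula for the mean of `tr(KΩ)`
requires symmetric `K`. -/
theorem trace_dualMat_mul {A : Matrix (Fin p) (Fin p) ℝ} (hA : A.IsSymm) (i j : Fin p) :
    (dualMat i j * A).trace = A i j := by
  rw [dualMat, Matrix.smul_mul, Matrix.add_mul, Matrix.trace_smul, Matrix.trace_add,
    Matrix.trace_single_mul, Matrix.trace_single_mul, hA.apply i j]
  simp only [smul_eq_mul, one_mul]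
  ring

theorem wishartR_mean {U : Matrix (Fin p) (Fin p) ℝ} (hU : U.PosDef) {α : Fin p → ℝ}
    (hα : ∀ i, G.paCard i + 2 < α i) :
    Integrable (fun Υ => Υ) (G.wishartR U α) ∧
      ∫ Υ, Υ ∂G.wishartR U α = G.proj (G.meanMat U α) := by
  have hψ : ∀ e : G.Edge, ∀ θ ∈ G.choleskySpace,
      G.psi θ e = (dualMat e.1.1 e.1.2 * G.precisionOf θ).trace := fun e θ hθ => by
    rw [trace_dualMat_mul (G.precisionOf_isSymm hθ)]; rfl
  have hI : ∀ e : G.Edge, Integrable (fun Υ : G.Incomplete => Υ e) (G.wishartR U α) := fun e =>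
    (G.integrable_wishartR_iff U α (f := fun Υ => Υ e) (hψ e)).2
      (G.wishart_mean_trace hU hα (dualMat_isSymm _ _)).1
  refine ⟨Integrable.of_eval hI, ?_⟩
  ext e
  rw [eval_integral hI, G.integral_wishartR U α (hψ e),
    (G.wishart_mean_trace hU hα (dualMat_isSymm _ _)).2, Matrix.trace_mul_comm,
    trace_dualMat_mul (G.meanMat_isSymm hU α)]
  rfl

end
end OrderedDAG

theorem theorem4p3 {p : ℕ} (G : OrderedDAG p) (U : Matrix (Fin p) (Fin p) ℝ) (hU : U.PosDef)
    (α : Fin p → ℝ) (hα : ∀ i, G.paCard i + 2 < α i) :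
    -- every incomplete precision matrix has exactly one completion
    (∀ Υ ∈ G.incompletePrecision, ∃! Ω, Ω ∈ G.precisionSpace ∧ G.proj Ω = Υ) ∧
    -- the density
    G.wishartR U α = (volume.restrict G.incompletePrecision).withDensity (fun Υ =>
      ENNReal.ofReal ((G.normConst U α)⁻¹ *
        Real.exp (-(1 / 2) * (G.completion Υ * U).trace) *
        ∏ i, G.schurAt (G.completion Υ)⁻¹ i ^ (-(1 / 2) * α i + G.paCard i + 2))) ∧
    -- the Laplace transform, first for an arbitrary symmetric matrix `K` paired with the
    -- completion, then at `K^E`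
    (∀ K : Matrix (Fin p) (Fin p) ℝ, K.IsSymm →
      (∀ i, (OrderedDAG.principal ((2 : ℝ) • K + U) (G.fa i)).PosDef) →
      Integrable (fun Υ => Real.exp (-(K * G.completion Υ).trace)) (G.wishartR U α) ∧
      ∫ Υ, Real.exp (-(K * G.completion Υ).trace) ∂(G.wishartR U α) =
        G.normConst ((2 : ℝ) • K + U) α / G.normConst U α) ∧
    (∀ K : Matrix (Fin p) (Fin p) ℝ, K.IsSymm →
      (∀ i, (OrderedDAG.principal ((2 : ℝ) • K + U) (G.fa i)).PosDef) →
      (∀ i j k, i ∈ G.pa k → j ∈ G.pa k → i ∉ G.fa j → j ∉ G.fa i → K i j = 0) →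
      Integrable (fun Υ => Real.exp (-(G.zeroFill (G.proj K) * G.zeroFill Υ).trace))
        (G.wishartR U α) ∧
      G.laplace (G.wishartR U α) (G.proj K) =
        G.normConst ((2 : ℝ) • K + U) α / G.normConst U α) ∧
    -- the mean
    Integrable (fun Υ => Υ) (G.wishartR U α) ∧
    ∫ Υ, Υ ∂(G.wishartR U α) =
      G.proj (∑ j, (α j - G.paCard j - 2) •
            OrderedDAG.zeroPad (OrderedDAG.principal U (G.fa j))⁻¹ -
          ∑ j, (α j - G.paCard j - 3) •
            OrderedDAG.zeroPad (OrderedDAG.principal U (G.pa j))⁻¹) := by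
  have hLap : ∀ K : Matrix (Fin p) (Fin p) ℝ, ∀ θ ∈ G.choleskySpace,
      Real.exp (-(K * G.completion (G.psi θ)).trace)
        = Real.exp (-(K * G.precisionOf θ).trace) := fun K θ hθ => by
    rw [G.completion_psi hθ]
  refine ⟨fun Υ hΥ => G.existsUnique_completion hΥ, G.wishartR_eq_withDensity U α,
    fun K hK hKU => ⟨?_, ?_⟩, fun K hK hKU h0 => ?_, G.wishartR_mean hU hα⟩
  · exact (G.integrable_wishartR_iff U α (f := fun Υ => Real.exp (-(K * G.completion Υ).trace))
      (hLap K)).2 (G.integrable_exp_wishart hU hα hK hKU)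
  · rw [G.integral_wishartR U α (hLap K), G.integral_exp_wishart hU hα hK hKU]
  · have hz : ∀ θ ∈ G.choleskySpace,
        Real.exp (-(G.zeroFill (G.proj K) * G.zeroFill (G.psi θ)).trace)
          = Real.exp (-(K * G.precisionOf θ).trace) := fun θ hθ => by
      rw [G.trace_zeroFill_mul_zeroFill hK h0 hθ]
    refine ⟨(G.integrable_wishartR_iff U α (f := fun Υ =>
      Real.exp (-(G.zeroFill (G.proj K) * G.zeroFill Υ).trace)) hz).2
        (G.integrable_exp_wishart hU hα hK hKU), ?_⟩
    rw [OrderedDAG.laplace, G.integral_wishartR U α hz, G.integral_exp_wishart hU hα hK hKU]
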